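/- **Theorem 5.** Let $f=h+\bar g$ be a harmonic mapping of the unit disk $\mathbb D$, with $h,g$ analytic and $|h'|+|g'|\neq 0$, whose dilatation $g'/h'$ is the square of a meromorphic function, so that there is an analytic $p$ with $(p')^2=h'g'$. Let $\tilde f=(\operatorname{Re} f,\operatorname{Im} f,2\operatorname{Im}p):\mathbb D\to\mathbb R^3$ be its Weierstrass–Enneper lift to the minimal surface $\Sigma=\tilde f(\mathbb D)$. Put $e^{\sigma}=|h'|+|g'|$ (so the induced metric is $e^{2\sigma}|dz|^2$), $\mathcal S\tilde f=2(\partial_{zz}\sigma-(\partial_z\sigma)^2)$, and let $K(\tilde f(z))=-e^{-2\sigma(z)}\Delta\sigma(z)$ be the Gaussian curvature. Suppose that for some $\rho$ with $0\le\rho\le1$ $$|\mathcal S\tilde f(z)|+e^{2\sigma(z)}|K(\tilde f(z))|\le\frac{2\rho}{(1-|z|^2)^2},\qquad z\in\mathbb D,$$ and that (the continuous extension with values in $\overline{\mathbb R^3}=\mathbb R^3\cup\{\infty\}$ of) $\tilde f$ is injective on $\partial\mathbb D$. For $\zeta\in\mathbb D$ let $\mathcal M\tilde f(\cdot,\zeta)$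 be the best Möbius approximation to $\tilde f$ at $\zeta$, i.e. the Möbius transformation of $\overline{\mathbb R^3}$ which on $\mathbb C=\mathbb R^2\times\{0\}$ is $$\mathcal M\tilde f(z,\zeta)=\tilde f(\zeta)+\operatorname{Re}\{m(z,\zeta)\}\,\partial_x\tilde f(\zeta)+\operatorname{Im}\{m(z,\zeta)\}\,\partial_y\tilde f(\zeta),\qquad m(z,\zeta)=\frac{z-\zeta}{1-\partial_z\sigma(\zeta)(z-\zeta)},$$ and which maps the upper half-space to the half-space over the tangent plane of $\Sigma$ at $\tilde f(\zeta)$ determined by the normal $\partial_x\tilde f\times\partial_y\tilde f$. Let $C_\zeta$ be the circle through $\zeta$ and $\zeta^*=1/\bar\zeta$ orthogonal to $\mathbb D$ (the vertical line through $0$, together with $\infty$, if $\zeta=0$), so that $\mathcal M\tilde f(C_\zeta,\zeta)$ is a circle or line orthogonal to $\Sigma$ at $\tilde f(\zeta)$, and let $\mathcal R(\tilde f(\zeta))=\mathcal M\tilde f(\zeta^*,\zeta)$ be the point diametrically opposite $\tilde f(\zeta)$ on it ($\infty$ if it is a line). Let $\mathcal E\tilde f:\overline{\mathbb R^3}\to\overline{\mathbb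 R^3}$ be given by $\mathcal E\tilde f(p)=\mathcal M\tilde f(p,\zeta)$ for $p\in C_\zeta$, $\zeta\in\mathbb D$, and $\mathcal E\tilde f=\tilde f$ on $\partial\mathbb D$. Let $d$ be the spherical metric on $\overline{\mathbb R^3}$. Then $$d\big(\mathcal R(\tilde f(\zeta)),\tilde f(\zeta)\big)\to0\quad\text{as }|\zeta|\to1.$$ Hence $\mathcal R$ fixes $\partial\Sigma=\tilde f(\partial\mathbb D)$ pointwise, in the sense that for every $\zeta_0\in\partial\mathbb D$ both $\tilde f(\zeta)\to\tilde f(\zeta_0)$ and $\mathcal R(\tilde f(\zeta))\to\tilde f(\zeta_0)$ in $\overline{\mathbb R^3}$ as $\zeta\to\zeta_0$, $\zeta\in\mathbb D$; and $\mathcal E\tilde f$ is continuous at every point of $\partial\mathbb D$. -/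

import Mathlib

open Set Filter Topology

namespace HarmonicLift

noncomputable section

/-- Euclidean space `ℝ³`; the Möbius space `ℝ³ ∪ {∞}` is `OnePoint E3`. -/
abbrev E3 : Type := EuclideanSpace ℝ (Fin 3)

/-- The open unit disk. -/
def disk : Set ℂ := Metric.ball 0 1

/-- The unit circle. -/
def circle : Set ℂ := Metric.sphere 0 1

/-- `ℂ` as the coordinate plane `x₂ = 0` of `ℝ³`. -/
def embed (z : ℂ) : E3 := !₂[z.re, z.im, 0]

/-! ### The Weierstrass-Enneper lift and its Schwarzian -/

/-- `F` is a Weierstrass-Enneper lift, over the unit disk, of the harmonic map `f = h + conj g`: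
`h, g` are analytic, `|h'| + |g'| ≠ 0`, and the components of `F` are `Re f`, `Im f` and
`2 Im p`, where `p' = q h'` for a meromorphic square root `q` of the dilatation `g' / h'`.
In the equation `p' ^ 2 = h' g'` the function `p'` is this analytic function `q h'`;
conversely `q = p' / h'`. The additive constant and the sign of `p` are arbitrary. -/
structure IsWeierstrassEnneperLift (h g : ℂ → ℂ) (F : ℂ → E3) : Prop where
  analytic_h : DifferentiableOn ℂ h disk
  analytic_g : DifferentiableOn ℂ g disk
  deriv_ne_zero : ∀ z ∈ disk, ‖deriv h z‖ + ‖deriv g z‖ ≠ 0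
  lift : ∃ p : ℂ → ℂ, DifferentiableOn ℂ p disk ∧
    (∀ z ∈ disk, deriv p z ^ 2 = deriv h z * deriv g z) ∧
    ∀ z ∈ disk, F z = !₂[(h z + (starRingEnd ℂ) (g z)).re,
      (h z + (starRingEnd ℂ) (g z)).im, 2 * (p z).im]

/-- `σ`, where `e ^ σ = |h'| + |g'|`; the metric induced by the lift is `e ^ (2 σ) |dz|²`. -/
def sigma (h g : ℂ → ℂ) (z : ℂ) : ℝ := Real.log (‖deriv h z‖ + ‖deriv g z‖)

/-- The complex derivative `∂_z u = (∂_x u - i ∂_y u) / 2`. -/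
def dz (u : ℂ → ℂ) (z : ℂ) : ℂ :=
  (1 / 2 : ℂ) * (fderiv ℝ u z 1 - Complex.I * fderiv ℝ u z Complex.I)

/-- `∂_z σ`. -/
def dzSigma (h g : ℂ → ℂ) : ℂ → ℂ := dz (fun z => (sigma h g z : ℂ))

/-- The Schwarzian derivative `2 (∂_zz σ - (∂_z σ)²)` of the lift. -/
def schwarzian (h g : ℂ → ℂ) (z : ℂ) : ℂ :=
  2 * (dz (dzSigma h g) z - dzSigma h g z ^ 2)

/-- The Gaussian curvature `- e ^ (-2 σ) Δ σ` of the surface at the image of `z`. -/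
def gaussCurvature (h g : ℂ → ℂ) (z : ℂ) : ℝ :=
  -Real.exp (-2 * sigma h g z) * Laplacian.laplacian (sigma h g) z

/-- The Ahlfors-Weill type condition with constant `ρ`. -/
def AhlforsWeillCondition (h g : ℂ → ℂ) (ρ : ℝ) : Prop :=
  ∀ z ∈ disk, ‖schwarzian h g z‖ + Real.exp (2 * sigma h g z) * |gaussCurvature h g z| ≤
    2 * ρ / (1 - ‖z‖ ^ 2) ^ 2

/-- The extension of `F` to the closed disk by its limits from inside the disk, with values in
`ℝ³ ∪ {∞}`. -/
def boundaryExt (F : ℂ → E3) : ℂ → OnePoint E3 :=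
  extendFrom disk (fun z => (F z : OnePoint E3))

/-! ### Best Möbius approximations -/

/-- The Möbius transformation of `ℝ³ ∪ {∞}` that extends `z ↦ 1 / z` and preserves the upper
half-space. -/
def spaceInv : OnePoint E3 → OnePoint E3
  | OnePoint.infty => ((0 : E3) : OnePoint E3)
  | OnePoint.some u =>
      open Classical in
      if u = 0 then OnePoint.infty
      else (((‖u‖ ^ 2)⁻¹ • (!₂[u 0, -u 1, u 2] : E3) : E3) : OnePoint E3)

/-- The extension to `ℝ³ ∪ {∞}`, preserving the upper half-space, of
`m(z, ζ) = (z - ζ) / (1 - ∂_ζ σ(ζ) (z - ζ)) = 1 / (1 / (z - ζ) - ∂_ζ σ(ζ))`. -/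
def spaceM (h g : ℂ → ℂ) (ζ : ℂ) (p : OnePoint E3) : OnePoint E3 :=
  spaceInv (OnePoint.map (fun u => u - embed (dzSigma h g ζ))
    (spaceInv (OnePoint.map (fun u => u - embed ζ) p)))

/-- The affine similarity of `ℝ³` that maps `0` to `F ζ`, the coordinate plane to the tangent
plane of the surface at `F ζ` by `x + i y ↦ F ζ + x ∂_ξ F(ζ) + y ∂_η F(ζ)`, and the third
coordinate direction to the oriented normal, scaled by `e ^ σ(ζ)`. -/
def tangentFrame (h g : ℂ → ℂ) (F : ℂ → E3) (ζ : ℂ) (u : E3) : E3 :=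
  F ζ + u 0 • fderiv ℝ F ζ 1 + u 1 • fderiv ℝ F ζ Complex.I +
    u 2 • (Real.exp (-sigma h g ζ) •
      (WithLp.toLp 2 (crossProduct (WithLp.ofLp (fderiv ℝ F ζ 1))
        (WithLp.ofLp (fderiv ℝ F ζ Complex.I))) : E3))

/-- The best Möbius approximation of the lift at `ζ`. -/
def bestMobius (h g : ℂ → ℂ) (F : ℂ → E3) (p : OnePoint E3) (ζ : ℂ) : OnePoint E3 :=
  OnePoint.map (tangentFrame h g F ζ) (spaceM h g ζ p)

/-! ### Circle bundles, reflection and extension -/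

/-- The point `ζ* = 1 / conj ζ`, with `0* = ∞`. -/
def reflectPoint (ζ : ℂ) : OnePoint E3 :=
  open Classical in
  if ζ = 0 then OnePoint.infty else ((embed ((starRingEnd ℂ) ζ)⁻¹ : E3) : OnePoint E3)

/-- The circle in `ℝ³ ∪ {∞}` through `ζ` and `ζ*` orthogonal to the disk: the vertical line
through the origin for `ζ = 0`; otherwise the circle with diameter from `ζ` to `ζ*` in the
vertical plane through `0` and `ζ`. -/
def diskCircle (ζ : ℂ) : Set (OnePoint E3) :=
  open Classical in
  if ζ = 0 then insert OnePoint.infty ((↑) '' {u : E3 | u 0 = 0 ∧ u 1 = 0})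
  else (↑) '' {u : E3 | (∃ s : ℝ, (⟨u 0, u 1⟩ : ℂ) = s * ζ) ∧
    inner ℝ (u - embed ζ) (u - embed ((starRingEnd ℂ) ζ)⁻¹) = 0}

/-- The circle of the bundle on the surface with base point `F ζ`. -/
def surfaceCircle (h g : ℂ → ℂ) (F : ℂ → E3) (ζ : ℂ) : Set (OnePoint E3) :=
  (fun p => bestMobius h g F p ζ) '' diskCircle ζ

/-- `R(F ζ)`, the point of the circle `surfaceCircle h g F ζ` diametrically opposite `F ζ`
(the point `∞` if that circle is a line): the image under the best Möbius approximation at `ζ`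
of the point `ζ*`, which is diametrically opposite `ζ` on `diskCircle ζ`. -/
def reflection (h g : ℂ → ℂ) (F : ℂ → E3) (ζ : ℂ) : OnePoint E3 :=
  bestMobius h g F (reflectPoint ζ) ζ

/-- The extension of `F` to `ℝ³ ∪ {∞}`: the best Möbius approximation at `ζ` on the circle
`diskCircle ζ`, for each `ζ` in the disk, and the boundary values of `F` on the unit circle
(the points on no circle `diskCircle ζ`). -/
def spaceExt (h g : ℂ → ℂ) (F : ℂ → E3) (p : OnePoint E3) : OnePoint E3 :=
  open Classical in
  if hp : ∃ ζ ∈ disk, p ∈ diskCircle ζ then bestMobius h g F p hp.choose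
  else match p with
    | OnePoint.infty => OnePoint.infty
    | OnePoint.some u => boundaryExt F ⟨u 0, u 1⟩

/-! ### The spherical metric -/

/-- Half of the chordal distance of the images of two points of `ℝ³ ∪ {∞}` under inverse
stereographic projection to the unit sphere of `ℝ⁴`. -/
def halfChord : OnePoint E3 → OnePoint E3 → ℝ
  | OnePoint.some u, OnePoint.some v =>
      ‖u - v‖ / (Real.sqrt (1 + ‖u‖ ^ 2) * Real.sqrt (1 + ‖v‖ ^ 2))
  | OnePoint.some u, OnePoint.infty => 1 / Real.sqrt (1 + ‖u‖ ^ 2)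
  | OnePoint.infty, OnePoint.some v => 1 / Real.sqrt (1 + ‖v‖ ^ 2)
  | OnePoint.infty, OnePoint.infty => 0

/-- The spherical (geodesic) distance on `ℝ³ ∪ {∞}`, of line element
`2 |dx| / (1 + |x|²)`. -/
def sphericalDist (a b : OnePoint E3) : ℝ := 2 * Real.arcsin (halfChord a b)

end

end HarmonicLift

open HarmonicLift

namespace HarmonicLift

noncomputable section

open scoped ComplexConjugate

open EuclideanGeometry (inversion)

/-! Fix a unit `η` and follow the space curve `r ↦ F (r η)`. Since `F` is the real part of a null
curve in `ℂ³`, the Ahlfors Schwarzian of this curve is at most `|S| + e^{2σ}|K|`, hence at most `2 /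
(1 - r²)²` (`ahlforsSchwarzian_reVec_le`, `isNehariCurve`). By a Sturm type argument `W = |F - F 0|
/ √(e^σ (1 - r²))` is then convex in hyperbolic arc length. It starts at `0` with slope
`√(e^{σ(0)})`, so its slope stays at least that large and `W` grows at least linearly in the
hyperbolic distance `L` (`le_curveSlope`, `le_curveWeight`).

Now invert space in the unit sphere about `F 0`. The inverted curve has speed `1 / (W² (1 - r²))`,
so its variation beyond radius `r` is at most `1 / (e^{σ(0)} L(r))`, uniformly in `η`. This gives
the inverted lift a limit at every boundary point (`dist_inversion_le`, `exists_tendsto_inversion`).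

The circles of the bundle obey the same bound. Inverted at its own base point, the circle over `F z`
is a line normal to the surface, so its points are explicit. Cauchy-Schwarz shows that after
inversion about `F 0` each lies within `e^σ / l` of the image of `F z`, where `l` is `e^σ` times `W`
times the hyperbolic slope of `W` (`dist_inversion_add_smul_le`). The two convexity bounds give `e^σ
/ l ≤ 1 / (e^{σ(0)} L)` (`slope_lower_bound`, `exists_uninvert_eq`). So whole circles, and the
reflected points on them, shrink to the boundary value of the lift. Undoing the inversion is
continuous into `ℝ³ ∪ {∞}`, and the base point of a circle passing near `ζ` on the unit circle is
itself near `ζ`, which gives continuity of the extension. -/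

/-! ### Hyperbolic convexity of the weighted distance along a curve. -/

/-- Nonnegativity behind the convexity of `|x| / √|a|`; here `x, a, b, c` are a curve seen from a
base point and its first three derivatives. -/
theorem logDeriv_riccati_nonneg {E : Type*} [NormedAddCommGroup E] [InnerProductSpace ℝ E]
    {x a : E} (b c : E) (hx : x ≠ 0) (ha : a ≠ 0) :
    0 ≤ (((inner ℝ x b + inner ℝ a a) * ‖x‖ ^ 2 - inner ℝ x a * (2 * inner ℝ x a)) / (‖x‖ ^ 2) ^ 2
      - 1 / 2 * (((inner ℝ b b + inner ℝ c a) * ‖a‖ ^ 2 - inner ℝ b a * (2 * inner ℝ a b)) /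
        (‖a‖ ^ 2) ^ 2))
      + (inner ℝ x a / ‖x‖ ^ 2 - 1 / 2 * (inner ℝ b a / ‖a‖ ^ 2)) ^ 2
      + 1 / 2 * (inner ℝ c a / ‖a‖ ^ 2 - 3 * inner ℝ b a ^ 2 / ‖a‖ ^ 4
        + 3 / 2 * (‖b‖ ^ 2 / ‖a‖ ^ 2)) := by
  have hx' : ‖x‖ ≠ 0 := norm_ne_zero_iff.2 hx
  have ha' : ‖a‖ ≠ 0 := norm_ne_zero_iff.2 ha
  -- Completing the square: the whole expression equals the squared length of this vector divided by
  -- `|a|²`.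
  have key : 0 ≤ ‖(‖a‖ ^ 2 / ‖x‖ ^ 2) • x + (1 / 2 : ℝ) • b
      - (inner ℝ x a / ‖x‖ ^ 2 + inner ℝ b a / (2 * ‖a‖ ^ 2)) • a‖ ^ 2 / ‖a‖ ^ 2 := by positivity
  convert key using 1
  rw [← real_inner_self_eq_norm_sq ((‖a‖ ^ 2 / ‖x‖ ^ 2) • x + (1 / 2 : ℝ) • b - _)]
  simp only [inner_add_left, inner_add_right, inner_sub_left, inner_sub_right,
    real_inner_smul_left, real_inner_smul_right]
  rw [real_inner_comm x a, real_inner_comm x b, real_inner_comm b a]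
  simp only [real_inner_self_eq_norm_sq]
  generalize (inner ℝ x a : ℝ) = xa
  generalize (inner ℝ x b : ℝ) = xb
  generalize (inner ℝ b a : ℝ) = ba
  generalize (inner ℝ c a : ℝ) = ca
  field_simp
  ring

section Curve

variable {E : Type*} [NormedAddCommGroup E] [InnerProductSpace ℝ E]

/-- A regular curve on `(-1, 1)` with its first three derivatives, whose Ahlfors Schwarzian is at
most `2 / (1 - r²)²` on `(0, 1)`. -/
structure IsNehariCurve (φ φ₁ φ₂ φ₃ : ℝ → E) : Prop where
  deriv₀ : ∀ r ∈ Ioo (-1 : ℝ) 1, HasDerivAt φ (φ₁ r) r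
  deriv₁ : ∀ r ∈ Ioo (-1 : ℝ) 1, HasDerivAt φ₁ (φ₂ r) r
  deriv₂ : ∀ r ∈ Ioo (-1 : ℝ) 1, HasDerivAt φ₂ (φ₃ r) r
  ne_zero : ∀ r ∈ Ioo (-1 : ℝ) 1, φ₁ r ≠ 0
  schwarzian_le : ∀ r ∈ Ioo (0 : ℝ) 1,
    inner ℝ (φ₃ r) (φ₁ r) / ‖φ₁ r‖ ^ 2 - 3 * inner ℝ (φ₂ r) (φ₁ r) ^ 2 / ‖φ₁ r‖ ^ 4
      + 3 / 2 * (‖φ₂ r‖ ^ 2 / ‖φ₁ r‖ ^ 2) ≤ 2 / (1 - r ^ 2) ^ 2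

/-- The distance from the initial point, weighted so that it is hyperbolically convex. -/
def curveWeight (φ φ₁ : ℝ → E) (r : ℝ) : ℝ := ‖φ r - φ 0‖ / √(‖φ₁ r‖ * (1 - r ^ 2))

/-- The logarithmic derivative of `curveWeight`. -/
def curveLogDeriv (φ φ₁ φ₂ : ℝ → E) (r : ℝ) : ℝ :=
  inner ℝ (φ r - φ 0) (φ₁ r) / ‖φ r - φ 0‖ ^ 2
    - 1 / 2 * (inner ℝ (φ₂ r) (φ₁ r) / ‖φ₁ r‖ ^ 2) + r / (1 - r ^ 2)

/-- The hyperbolic derivative of `curveWeight`. -/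
def curveSlope (φ φ₁ φ₂ : ℝ → E) (r : ℝ) : ℝ :=
  (1 - r ^ 2) * (curveWeight φ φ₁ r * curveLogDeriv φ φ₁ φ₂ r)

/-- The hyperbolic distance from `0` to `r` for the metric `|dz| / (1 - |z|²)`. -/
def hypDist (r : ℝ) : ℝ := (Real.log (1 + r) - Real.log (1 - r)) / 2

theorem hypDist_zero : hypDist 0 = 0 := by simp [hypDist]

theorem hasDerivAt_hypDist {r : ℝ} (hr : r ∈ Ioo (-1 : ℝ) 1) :
    HasDerivAt hypDist (1 / (1 - r ^ 2)) r := by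
  have h1 : (1 + r) ≠ 0 := by linarith [hr.1]
  have h2 : (1 - r) ≠ 0 := by linarith [hr.2]
  have h3 : (1 - r ^ 2) ≠ 0 := by
    rw [show 1 - r ^ 2 = (1 + r) * (1 - r) by ring]; exact mul_ne_zero h1 h2
  have := ((((hasDerivAt_id r).const_add 1).log h1).sub
    (((hasDerivAt_id r).const_sub 1).log h2)).div_const 2
  refine HasDerivAt.congr_deriv this ?_
  simp only [id]
  field_simp
  ring

theorem hypDist_pos {r : ℝ} (h0 : 0 < r) (h1 : r < 1) : 0 < hypDist r := by
  have : Real.log (1 - r) < Real.log (1 + r) := Real.log_lt_log (by linarith) (by linarith)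
  unfold hypDist
  linarith

theorem tendsto_hypDist : Tendsto hypDist (𝓝[<] 1) atTop := by
  have h1 : Tendsto (fun r : ℝ => -Real.log (1 - r)) (𝓝[<] 1) atTop := by
    refine tendsto_neg_atBot_atTop.comp (Real.tendsto_log_nhdsGT_zero.comp ?_)
    refine tendsto_nhdsWithin_iff.2 ⟨?_, ?_⟩
    · have : Tendsto (fun r : ℝ => 1 - r) (𝓝 1) (𝓝 (1 - 1)) := by
        exact (continuous_const.sub continuous_id).tendsto 1
      rw [sub_self] at this
      exact this.mono_left nhdsWithin_le_nhds
    · filter_upwards [self_mem_nhdsWithin] with r hr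
      simpa using hr
  have h2 : Tendsto (fun r : ℝ => -Real.log (1 - r) / 2) (𝓝[<] 1) atTop :=
    h1.atTop_div_const two_pos
  refine tendsto_atTop_mono' _ ?_ h2
  have : Ioo (0 : ℝ) 1 ∈ 𝓝[<] (1 : ℝ) := Ioo_mem_nhdsLT (by norm_num)
  filter_upwards [this] with r hr
  have : 0 ≤ Real.log (1 + r) := Real.log_nonneg (by linarith [hr.1])
  unfold hypDist
  linarith

theorem IsNehariCurve.curveWeight_pos {φ φ₁ φ₂ φ₃ : ℝ → E} (hφ : IsNehariCurve φ φ₁ φ₂ φ₃)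
    {r : ℝ} (hr : r ∈ Ioo (-1 : ℝ) 1) (hne : φ r ≠ φ 0) : 0 < curveWeight φ φ₁ r := by
  have h1 : 0 < 1 - r ^ 2 := by nlinarith [hr.1, hr.2]
  have h2 := norm_pos_iff.2 (hφ.ne_zero r hr)
  have h3 := norm_pos_iff.2 (sub_ne_zero.2 hne)
  unfold curveWeight
  positivity

theorem IsNehariCurve.hasDerivAt_curveWeight {φ φ₁ φ₂ φ₃ : ℝ → E}
    (hφ : IsNehariCurve φ φ₁ φ₂ φ₃) {r : ℝ} (hr : r ∈ Ioo (-1 : ℝ) 1) (hne : φ r ≠ φ 0) :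
    HasDerivAt (curveWeight φ φ₁) (curveWeight φ φ₁ r * curveLogDeriv φ φ₁ φ₂ r) r := by
  have h1 : 0 < 1 - r ^ 2 := by nlinarith [hr.1, hr.2]
  have h2 := norm_pos_iff.2 (hφ.ne_zero r hr)
  have h3 := norm_pos_iff.2 (sub_ne_zero.2 hne)
  have dn : HasDerivAt (fun t => ‖φ t - φ 0‖) (inner ℝ (φ r - φ 0) (φ₁ r) / ‖φ r - φ 0‖) r := by
    have := (((hφ.deriv₀ r hr).sub_const (φ 0)).norm_sq.sqrt (by positivity))
    simp only [Real.sqrt_sq (norm_nonneg _)] at this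
    refine HasDerivAt.congr_deriv this ?_
    field_simp
  have dv : HasDerivAt (fun t => ‖φ₁ t‖) (inner ℝ (φ₁ r) (φ₂ r) / ‖φ₁ r‖) r := by
    have := ((hφ.deriv₁ r hr).norm_sq.sqrt (by positivity))
    simp only [Real.sqrt_sq (norm_nonneg _)] at this
    refine HasDerivAt.congr_deriv this ?_
    field_simp
  have dq : HasDerivAt (fun t : ℝ => 1 - t ^ 2) (-(2 * r)) r := by
    simpa using (hasDerivAt_pow 2 r).const_sub 1
  have hsq : √(‖φ₁ r‖ * (1 - r ^ 2)) ≠ 0 := by positivity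
  have dvq : HasDerivAt (fun t => ‖φ₁ t‖ * (1 - t ^ 2))
      (inner ℝ (φ₁ r) (φ₂ r) / ‖φ₁ r‖ * (1 - r ^ 2) + ‖φ₁ r‖ * -(2 * r)) r := dv.mul dq
  refine HasDerivAt.congr_deriv (dn.div (dvq.sqrt (by positivity)) hsq) ?_
  rw [real_inner_comm (φ₂ r) (φ₁ r)]
  unfold curveWeight curveLogDeriv
  have hs2 : √(‖φ₁ r‖ * (1 - r ^ 2)) ^ 2 = ‖φ₁ r‖ * (1 - r ^ 2) := Real.sq_sqrt (by positivity)
  set s := √(‖φ₁ r‖ * (1 - r ^ 2))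
  have h1' := h1.ne'
  field_simp
  rw [hs2]
  field_simp
  ring

/-- With `l` the logarithmic derivative of `|φ - φ 0| / √|φ₁|`, the derivative is `(1 - r²) W (l' +
l² + 1 / (1 - r²)²)`. The Riccati inequality gives `l' + l² ≥ -S/2` for the Ahlfors Schwarzian `S`,
and `S/2 ≤ 1 / (1 - r²)²`. -/
theorem IsNehariCurve.curveSlope_deriv_nonneg {φ φ₁ φ₂ φ₃ : ℝ → E}
    (hφ : IsNehariCurve φ φ₁ φ₂ φ₃) {r : ℝ} (hr : r ∈ Ioo (0 : ℝ) 1) (hne : φ r ≠ φ 0) :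
    ∃ d, 0 ≤ d ∧ HasDerivAt (curveSlope φ φ₁ φ₂) d r := by
  have hr' : r ∈ Ioo (-1 : ℝ) 1 := ⟨by linarith [hr.1], hr.2⟩
  have h1 : 0 < 1 - r ^ 2 := by nlinarith [hr.1, hr.2]
  have h2 := norm_pos_iff.2 (hφ.ne_zero r hr')
  have h3 := norm_pos_iff.2 (sub_ne_zero.2 hne)
  have dx := (hφ.deriv₀ r hr').sub_const (φ 0)
  have d1 := hφ.deriv₁ r hr'
  have d2 := hφ.deriv₂ r hr'
  have dq : HasDerivAt (fun t : ℝ => 1 - t ^ 2) (-(2 * r)) r := by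
    simpa using (hasDerivAt_pow 2 r).const_sub 1
  have dl := (((dx.inner ℝ d1).div dx.norm_sq (by positivity)).sub
    (((d2.inner ℝ d1).div d1.norm_sq (by positivity)).const_mul (1 / 2 : ℝ))).add
    ((hasDerivAt_id r).div dq h1.ne')
  have dA := dq.mul ((hφ.hasDerivAt_curveWeight hr' hne).mul dl)
  refine ⟨_, ?_, dA⟩
  have hW := hφ.curveWeight_pos hr' hne
  have key := logDeriv_riccati_nonneg (φ₂ r) (φ₃ r) (sub_ne_zero.2 hne) (hφ.ne_zero r hr')
  have hS := hφ.schwarzian_le r hr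
  rw [real_inner_comm (φ₁ r) (φ₁ r)] at key
  simp only [Pi.mul_apply, Pi.sub_apply, Pi.add_apply, Pi.div_apply, id]
  have hl : curveLogDeriv φ φ₁ φ₂ r = inner ℝ (φ r - φ 0) (φ₁ r) / ‖φ r - φ 0‖ ^ 2
    - 1 / 2 * (inner ℝ (φ₂ r) (φ₁ r) / ‖φ₁ r‖ ^ 2) + r / (1 - r ^ 2) := rfl
  rw [hl, real_inner_self_eq_norm_sq (φ₂ r)]
  rw [real_inner_self_eq_norm_sq (φ₂ r)] at key
  set Q := ((inner ℝ (φ r - φ 0) (φ₂ r) + inner ℝ (φ₁ r) (φ₁ r)) * ‖φ r - φ 0‖ ^ 2 -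
    inner ℝ (φ r - φ 0) (φ₁ r) * (2 * inner ℝ (φ r - φ 0) (φ₁ r))) / (‖φ r - φ 0‖ ^ 2) ^ 2
  set Q' := ((‖φ₂ r‖ ^ 2 + inner ℝ (φ₃ r) (φ₁ r)) * ‖φ₁ r‖ ^ 2 -
    inner ℝ (φ₂ r) (φ₁ r) * (2 * inner ℝ (φ₁ r) (φ₂ r))) / (‖φ₁ r‖ ^ 2) ^ 2
  set l := inner ℝ (φ r - φ 0) (φ₁ r) / ‖φ r - φ 0‖ ^ 2
    - 1 / 2 * (inner ℝ (φ₂ r) (φ₁ r) / ‖φ₁ r‖ ^ 2)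
  have h4 : 0 ≤ Q - 1 / 2 * Q' + l ^ 2 + 1 / (1 - r ^ 2) ^ 2 := by
    have : 1 / (1 - r ^ 2) ^ 2 = 1 / 2 * (2 / (1 - r ^ 2) ^ 2) := by ring
    linarith
  have h5 := mul_nonneg (mul_nonneg h1.le hW.le) h4
  refine h5.trans_eq ?_
  have h1' := h1.ne'
  field_simp
  ring

theorem IsNehariCurve.tendsto_slope {φ φ₁ φ₂ φ₃ : ℝ → E} (hφ : IsNehariCurve φ φ₁ φ₂ φ₃) :
    Tendsto (fun r : ℝ => r⁻¹ • (φ r - φ 0)) (𝓝[>] 0) (𝓝 (φ₁ 0)) := by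
  have := (hφ.deriv₀ 0 (by norm_num)).tendsto_slope_zero_right
  simpa using this

theorem IsNehariCurve.eventually_ne {φ φ₁ φ₂ φ₃ : ℝ → E} (hφ : IsNehariCurve φ φ₁ φ₂ φ₃) :
    ∀ᶠ r in 𝓝[>] (0 : ℝ), φ r ≠ φ 0 := by
  filter_upwards [hφ.tendsto_slope.eventually_ne (hφ.ne_zero 0 (by norm_num))] with r hr h
  simp [h] at hr

theorem IsNehariCurve.tendsto_curveSlope {φ φ₁ φ₂ φ₃ : ℝ → E} (hφ : IsNehariCurve φ φ₁ φ₂ φ₃) :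
    Tendsto (curveSlope φ φ₁ φ₂) (𝓝[>] 0) (𝓝 √‖φ₁ 0‖) := by
  have h0 : (0 : ℝ) ∈ Ioo (-1 : ℝ) 1 := by norm_num
  have hv := norm_pos_iff.2 (hφ.ne_zero 0 h0)
  have c0 : Tendsto φ (𝓝[>] 0) (𝓝 (φ 0)) :=
    (hφ.deriv₀ 0 h0).continuousAt.tendsto.mono_left nhdsWithin_le_nhds
  have c1 : Tendsto φ₁ (𝓝[>] 0) (𝓝 (φ₁ 0)) :=
    (hφ.deriv₁ 0 h0).continuousAt.tendsto.mono_left nhdsWithin_le_nhds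
  have c2 : Tendsto φ₂ (𝓝[>] 0) (𝓝 (φ₂ 0)) :=
    (hφ.deriv₂ 0 h0).continuousAt.tendsto.mono_left nhdsWithin_le_nhds
  have ci : Tendsto (fun r : ℝ => r) (𝓝[>] 0) (𝓝 0) := nhdsWithin_le_nhds
  have cq : Tendsto (fun r : ℝ => 1 - r ^ 2) (𝓝[>] 0) (𝓝 (1 - 0 ^ 2)) := (ci.pow 2).const_sub 1
  have cn : Tendsto (fun r => ‖φ r - φ 0‖) (𝓝[>] 0) (𝓝 ‖φ 0 - φ 0‖) := (c0.sub_const _).norm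
  have cs := hφ.tendsto_slope
  have hs0 : √(‖φ₁ 0‖ * (1 - 0 ^ 2)) ≠ 0 := by
    have : (0 : ℝ) < 1 - 0 ^ 2 := by norm_num
    positivity
  -- The slope is regrouped so that `φ r - φ 0` enters the singular term only through the difference
  -- quotient; each factor then has a limit at `0`.
  have main := (cq.div (c1.norm.mul cq).sqrt hs0).mul
    (((cs.inner (𝕜 := ℝ) c1).div cs.norm hv.ne').add (cn.mul
      ((ci.div cq (by norm_num)).sub
        (((c2.inner (𝕜 := ℝ) c1).div (c1.norm.pow 2) (by positivity)).const_mul (1 / 2 : ℝ)))))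
  have hlim : (1 - 0 ^ 2) / √(‖φ₁ 0‖ * (1 - 0 ^ 2)) * (inner ℝ (φ₁ 0) (φ₁ 0) / ‖φ₁ 0‖ +
      ‖φ 0 - φ 0‖ * (0 / (1 - 0 ^ 2) - 1 / 2 * (inner ℝ (φ₂ 0) (φ₁ 0) / ‖φ₁ 0‖ ^ 2)))
      = √‖φ₁ 0‖ := by
    rw [real_inner_self_eq_norm_sq]
    have : √‖φ₁ 0‖ ≠ 0 := by positivity
    have h2 := Real.sq_sqrt hv.le
    norm_num only [sub_self, norm_zero, zero_mul, add_zero, mul_one]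
    field_simp
    rw [h2]
  rw [hlim] at main
  refine main.congr' ?_
  filter_upwards [hφ.eventually_ne, Ioo_mem_nhdsGT (show (0 : ℝ) < 1 by norm_num)] with r hne hr
  have h1 : 0 < 1 - r ^ 2 := by nlinarith [hr.1, hr.2]
  have hr0 := hr.1
  have h2 := norm_pos_iff.2 (hφ.ne_zero r ⟨by linarith [hr.1], hr.2⟩)
  have h3 := norm_pos_iff.2 (sub_ne_zero.2 hne)
  have h4 : 0 < √(‖φ₁ r‖ * (1 - r ^ 2)) := by positivity
  simp only [Pi.div_apply]
  unfold curveSlope curveWeight curveLogDeriv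
  rw [real_inner_smul_left, norm_smul, norm_inv, Real.norm_of_nonneg hr0.le]
  field_simp
  ring

/-- A monotone slope dominates its limit at `0`. The logarithmic derivative needs `φ ≠ φ 0`, so the
bound is first obtained up to a radius `R` free of returns; `ne_initial` then removes this
restriction. -/
theorem IsNehariCurve.le_curveSlope_of_ne {φ φ₁ φ₂ φ₃ : ℝ → E} (hφ : IsNehariCurve φ φ₁ φ₂ φ₃)
    {R : ℝ} (hR : R ≤ 1) (hne : ∀ r ∈ Ioo 0 R, φ r ≠ φ 0) {r : ℝ} (hr : r ∈ Ioo 0 R) :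
    √‖φ₁ 0‖ ≤ curveSlope φ φ₁ φ₂ r := by
  have hd : ∀ t ∈ Ioo 0 R, ∃ d, 0 ≤ d ∧ HasDerivAt (curveSlope φ φ₁ φ₂) d t := fun t ht =>
    hφ.curveSlope_deriv_nonneg ⟨ht.1, ht.2.trans_le hR⟩ (hne t ht)
  have mono : MonotoneOn (curveSlope φ φ₁ φ₂) (Ioo 0 R) := by
    refine monotoneOn_of_deriv_nonneg (convex_Ioo 0 R) ?_ ?_ ?_
    · intro t ht
      obtain ⟨d, -, h⟩ := hd t ht
      exact h.continuousAt.continuousWithinAt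
    · intro t ht
      rw [interior_Ioo] at ht
      obtain ⟨d, -, h⟩ := hd t ht
      exact h.differentiableAt.differentiableWithinAt
    · intro t ht
      rw [interior_Ioo] at ht
      obtain ⟨d, h0, h⟩ := hd t ht
      rwa [h.deriv]
  refine le_of_tendsto hφ.tendsto_curveSlope ?_
  filter_upwards [Ioo_mem_nhdsGT hr.1] with t ht
  exact mono ⟨ht.1, ht.2.trans hr.2⟩ hr ht.2.le

theorem IsNehariCurve.continuousOn_curveWeight {φ φ₁ φ₂ φ₃ : ℝ → E}
    (hφ : IsNehariCurve φ φ₁ φ₂ φ₃) : ContinuousOn (curveWeight φ φ₁) (Ioo (-1) 1) := by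
  intro r hr
  have h1 : 0 < 1 - r ^ 2 := by nlinarith [hr.1, hr.2]
  have h2 := norm_pos_iff.2 (hφ.ne_zero r hr)
  refine ContinuousAt.continuousWithinAt ?_
  refine ((hφ.deriv₀ r hr).continuousAt.sub continuousAt_const).norm.div
    (((hφ.deriv₁ r hr).continuousAt.norm.mul (by fun_prop)).sqrt) (by positivity)

theorem IsNehariCurve.le_curveWeight_of_ne {φ φ₁ φ₂ φ₃ : ℝ → E} (hφ : IsNehariCurve φ φ₁ φ₂ φ₃)
    {R : ℝ} (hR : R ≤ 1) (hne : ∀ r ∈ Ioo 0 R, φ r ≠ φ 0) {r : ℝ} (hr : r ∈ Icc 0 R)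
    (hr1 : r < 1) : √‖φ₁ 0‖ * hypDist r ≤ curveWeight φ φ₁ r := by
  have hsub : Icc 0 r ⊆ Ioo (-1 : ℝ) 1 := fun t ht =>
    ⟨by linarith [ht.1], lt_of_le_of_lt ht.2 hr1⟩
  have mono : MonotoneOn (fun t => curveWeight φ φ₁ t - √‖φ₁ 0‖ * hypDist t) (Icc 0 r) := by
    have hd : ∀ t ∈ Ioo 0 r, HasDerivAt (fun t => curveWeight φ φ₁ t - √‖φ₁ 0‖ * hypDist t)
        (curveWeight φ φ₁ t * curveLogDeriv φ φ₁ φ₂ t - √‖φ₁ 0‖ * (1 / (1 - t ^ 2))) t :=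
      fun t ht => (hφ.hasDerivAt_curveWeight (hsub (Ioo_subset_Icc_self ht))
        (hne t ⟨ht.1, ht.2.trans_le hr.2⟩)).sub
        ((hasDerivAt_hypDist (hsub (Ioo_subset_Icc_self ht))).const_mul _)
    refine monotoneOn_of_deriv_nonneg (convex_Icc 0 r) ?_ ?_ ?_
    · refine (hφ.continuousOn_curveWeight.mono hsub).sub (continuousOn_const.mul ?_)
      exact fun t ht => (hasDerivAt_hypDist (hsub ht)).continuousAt.continuousWithinAt
    · intro t ht
      rw [interior_Icc] at ht
      exact (hd t ht).differentiableAt.differentiableWithinAt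
    · intro t ht
      rw [interior_Icc] at ht
      rw [(hd t ht).deriv]
      have h1 : 0 < 1 - t ^ 2 := by nlinarith [ht.1, ht.2]
      have h2 := hφ.le_curveSlope_of_ne hR hne ⟨ht.1, ht.2.trans_le hr.2⟩
      unfold curveSlope at h2
      rw [mul_one_div, sub_nonneg, div_le_iff₀ h1]
      linarith
  have := mono ⟨le_rfl, hr.1⟩ ⟨hr.1, le_rfl⟩ hr.1
  simp only [hypDist_zero, mul_zero, sub_zero] at this
  have h0 : curveWeight φ φ₁ 0 = 0 := by simp [curveWeight]
  linarith

/-- A Nehari curve does not return to its initial point. -/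
theorem IsNehariCurve.ne_initial {φ φ₁ φ₂ φ₃ : ℝ → E} (hφ : IsNehariCurve φ φ₁ φ₂ φ₃) {r : ℝ}
    (hr : r ∈ Ioo (0 : ℝ) 1) : φ r ≠ φ 0 := by
  intro hbad
  obtain ⟨δ, hδ, hδ'⟩ := mem_nhdsGT_iff_exists_Ioo_subset.1 hφ.eventually_ne
  have hδ0 : (0 : ℝ) < δ := hδ
  have hδr : δ ≤ r := by
    by_contra! h
    exact hδ' ⟨hr.1, h⟩ hbad
  have hcomp : IsCompact (Icc δ r ∩ φ ⁻¹' {φ 0}) := by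
    refine isCompact_Icc.of_isClosed_subset (ContinuousOn.preimage_isClosed_of_isClosed ?_
      isClosed_Icc isClosed_singleton) inter_subset_left
    exact fun t ht => (hφ.deriv₀ t ⟨by linarith [ht.1],
      lt_of_le_of_lt ht.2 hr.2⟩).continuousAt.continuousWithinAt
  -- `R` is the first return time. Cutting at `δ` excludes the trivial zero at `0`, so that the set
  -- of returns is compact.
  obtain ⟨R, ⟨hR, hRφ⟩, hmin⟩ := hcomp.exists_isLeast ⟨r, ⟨hδr, le_rfl⟩, hbad⟩
  have hR1 : R < 1 := lt_of_le_of_lt hR.2 hr.2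
  have hR0 : 0 < R := hδ0.trans_le hR.1
  have hne : ∀ t ∈ Ioo 0 R, φ t ≠ φ 0 := by
    intro t ht h
    rcases lt_or_ge t δ with h1 | h1
    · exact hδ' ⟨ht.1, h1⟩ h
    · exact absurd (hmin ⟨⟨h1, ht.2.le.trans hR.2⟩, h⟩) (not_le.2 ht.2)
  -- The weight vanishes at a return, yet by continuity the growth bound still holds at the endpoint
  -- `R` and makes it positive.
  have := hφ.le_curveWeight_of_ne hR1.le hne ⟨hR0.le, le_rfl⟩ hR1
  have hz : curveWeight φ φ₁ R = 0 := by
    have : φ R = φ 0 := hRφ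
    simp [curveWeight, this]
  have hv := norm_pos_iff.2 (hφ.ne_zero 0 (by norm_num))
  have := mul_pos (Real.sqrt_pos.2 hv) (hypDist_pos hR0 hR1)
  linarith

theorem IsNehariCurve.le_curveSlope {φ φ₁ φ₂ φ₃ : ℝ → E} (hφ : IsNehariCurve φ φ₁ φ₂ φ₃) {r : ℝ}
    (hr : r ∈ Ioo (0 : ℝ) 1) : √‖φ₁ 0‖ ≤ curveSlope φ φ₁ φ₂ r :=
  hφ.le_curveSlope_of_ne le_rfl (fun _ ht => hφ.ne_initial ht) hr

theorem IsNehariCurve.le_curveWeight {φ φ₁ φ₂ φ₃ : ℝ → E} (hφ : IsNehariCurve φ φ₁ φ₂ φ₃) {r : ℝ}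
    (hr : r ∈ Ioo (0 : ℝ) 1) : √‖φ₁ 0‖ * hypDist r ≤ curveWeight φ φ₁ r :=
  hφ.le_curveWeight_of_ne le_rfl (fun _ ht => hφ.ne_initial ht) ⟨hr.1.le, hr.2.le⟩ hr.2

/-- Control of the radial variation of the curve inverted at its initial point. -/
theorem IsNehariCurve.dist_inversion_le {φ φ₁ φ₂ φ₃ : ℝ → E} (hφ : IsNehariCurve φ φ₁ φ₂ φ₃)
    {a b : ℝ} (ha : 0 < a) (hab : a ≤ b) (hb : b < 1) :
    dist (EuclideanGeometry.inversion (φ 0) 1 (φ b)) (EuclideanGeometry.inversion (φ 0) 1 (φ a)) ≤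
      (‖φ₁ 0‖ * hypDist a)⁻¹ := by
  have hv := norm_pos_iff.2 (hφ.ne_zero 0 (by norm_num))
  have hI : ∀ t ∈ Icc a b, t ∈ Ioo (0 : ℝ) 1 := fun t ht =>
    ⟨ha.trans_le ht.1, lt_of_le_of_lt ht.2 hb⟩
  have hI' : ∀ t ∈ Icc a b, t ∈ Ioo (-1 : ℝ) 1 := fun t ht =>
    ⟨by linarith [(hI t ht).1], (hI t ht).2⟩
  set Φ : ℝ → E := fun t => EuclideanGeometry.inversion (φ 0) 1 (φ t)
  -- Inversion scales lengths by `1 / |φ t - φ 0|²`, so the inverted speed is `1 / (W² (1 - t²))`,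
  -- and the growth of `W` bounds it.
  have hd : ∀ t ∈ Icc a b, ∃ d : E, HasDerivAt Φ d t ∧
      ‖d‖ ≤ ‖φ₁ 0‖⁻¹ * ((1 / (1 - t ^ 2)) / hypDist t ^ 2) := by
    intro t ht
    have h1 : 0 < 1 - t ^ 2 := by nlinarith [(hI t ht).1, (hI t ht).2]
    have hx := norm_pos_iff.2 (sub_ne_zero.2 (hφ.ne_initial (hI t ht)))
    have hvt := norm_pos_iff.2 (hφ.ne_zero t (hI' t ht))
    have hL := hypDist_pos (hI t ht).1 (hI t ht).2
    refine ⟨_, (EuclideanGeometry.hasFDerivAt_inversion (R := 1)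
      (hφ.ne_initial (hI t ht))).comp_hasDerivAt t (hφ.deriv₀ t (hI' t ht)), ?_⟩
    have hW := hφ.le_curveWeight (hI t ht)
    have hW2 : (√‖φ₁ 0‖ * hypDist t) ^ 2 ≤ curveWeight φ φ₁ t ^ 2 :=
      pow_le_pow_left₀ (by positivity) hW 2
    rw [mul_pow, Real.sq_sqrt hv.le, curveWeight, div_pow, Real.sq_sqrt (by positivity),
      le_div_iff₀ (by positivity)] at hW2
    simp only [_root_.smul_apply, norm_smul]
    rw [Real.norm_of_nonneg (by positivity), dist_eq_norm]
    have : ‖(↑(Submodule.reflection (ℝ ∙ (φ t - φ 0))ᗮ) : E →L[ℝ] E) (φ₁ t)‖ = ‖φ₁ t‖ :=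
      (Submodule.reflection (ℝ ∙ (φ t - φ 0))ᗮ).norm_map _
    erw [this]
    rw [div_pow, one_pow, ← sub_nonneg]
    have e : ‖φ₁ 0‖⁻¹ * (1 / (1 - t ^ 2) / hypDist t ^ 2) - 1 / ‖φ t - φ 0‖ ^ 2 * ‖φ₁ t‖ =
        (‖φ t - φ 0‖ ^ 2 - ‖φ₁ 0‖ * hypDist t ^ 2 * (‖φ₁ t‖ * (1 - t ^ 2))) /
        (‖φ₁ 0‖ * (1 - t ^ 2) * hypDist t ^ 2 * ‖φ t - φ 0‖ ^ 2) := by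
      have h1' := h1.ne'
      field_simp
    rw [e]
    exact div_nonneg (by linarith) (by positivity)
  choose! d hd1 hd2 using hd
  -- Since `hypDist` has derivative `1 / (1 - t²)`, the speed bound has a primitive in terms of `-1
  -- / hypDist`.
  have hB : ∀ t ∈ Icc a b, HasDerivAt (fun t => ‖φ₁ 0‖⁻¹ * ((hypDist a)⁻¹ - (hypDist t)⁻¹))
      (‖φ₁ 0‖⁻¹ * ((1 / (1 - t ^ 2)) / hypDist t ^ 2)) t := by
    intro t ht
    have hL := hypDist_pos (hI t ht).1 (hI t ht).2
    have := (((hasDerivAt_hypDist (hI' t ht)).inv hL.ne').const_sub (hypDist a)⁻¹).const_mul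
      ‖φ₁ 0‖⁻¹
    exact this.congr_deriv (by ring)
  have := image_norm_le_of_norm_deriv_right_le_deriv_boundary' (f := fun t => Φ t - Φ a) (a := a)
    (b := b) (f' := d)
    (fun t ht => ((hd1 t ht).continuousAt.continuousWithinAt).sub continuousWithinAt_const)
    (fun t ht => ((hd1 t (Ico_subset_Icc_self ht)).sub_const _).hasDerivWithinAt)
    (by simp) (fun t ht => (hB t ht).continuousAt.continuousWithinAt)
    (fun t ht => (hB t (Ico_subset_Icc_self ht)).hasDerivWithinAt)
    (fun t ht => hd2 t (Ico_subset_Icc_self ht)) (x := b) ⟨hab, le_rfl⟩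
  rw [dist_eq_norm]
  refine this.trans ?_
  have hL := hypDist_pos (hI b ⟨hab, le_rfl⟩).1 hb
  rw [mul_inv]
  gcongr
  have := inv_pos.2 hL
  linarith

end Curve

/-! ### Wirtinger calculus. -/

section Wirtinger

/-- The real linear map `t ↦ A t + B conj t`. -/
def wirtingerCLM (A B : ℂ) : ℂ →L[ℝ] ℂ :=
  A • ContinuousLinearMap.id ℝ ℂ + B • (Complex.conjCLE : ℂ →L[ℝ] ℂ)

theorem wirtingerCLM_apply (A B t : ℂ) : wirtingerCLM A B t = A * t + B * conj t := by
  simp [wirtingerCLM]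

/-- `u` is real differentiable at `z` with `∂_z u = A` and `∂_{conj z} u = B`. -/
def HasWirtinger (u : ℂ → ℂ) (A B z : ℂ) : Prop := HasFDerivAt u (wirtingerCLM A B) z

theorem HasWirtinger.congr_coeff {u : ℂ → ℂ} {A B A' B' z : ℂ} (h : HasWirtinger u A B z)
    (hA : A = A') (hB : B = B') : HasWirtinger u A' B' z := hA ▸ hB ▸ h

theorem HasWirtinger.dz_eq {u : ℂ → ℂ} {A B z : ℂ} (h : HasWirtinger u A B z) : dz u z = A := by
  unfold HasWirtinger at h
  rw [dz, h.fderiv, wirtingerCLM_apply, wirtingerCLM_apply, map_one, Complex.conj_I]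
  linear_combination (-A / 2 + B / 2) * Complex.I_mul_I

theorem hasWirtinger_of_hasDerivAt {u : ℂ → ℂ} {a z : ℂ} (h : HasDerivAt u a z) :
    HasWirtinger u a 0 z := by
  refine h.complexToReal_fderiv.congr_fderiv ?_
  refine ContinuousLinearMap.ext fun t => ?_
  simp [wirtingerCLM_apply]

theorem HasWirtinger.conj {u : ℂ → ℂ} {A B z : ℂ} (h : HasWirtinger u A B z) :
    HasWirtinger (fun w => conj (u w)) (conj B) (conj A) z := by
  refine ((Complex.conjCLE : ℂ →L[ℝ] ℂ).hasFDerivAt.comp z h).congr_fderiv ?_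
  refine ContinuousLinearMap.ext fun t => ?_
  simp [wirtingerCLM_apply]
  ring

theorem HasWirtinger.mul {u v : ℂ → ℂ} {A B C D z : ℂ} (hu : HasWirtinger u A B z)
    (hv : HasWirtinger v C D z) :
    HasWirtinger (fun w => u w * v w) (A * v z + u z * C) (B * v z + u z * D) z := by
  refine (HasFDerivAt.mul' hu hv).congr_fderiv ?_
  refine ContinuousLinearMap.ext fun t => ?_
  simp [wirtingerCLM_apply]
  ring

theorem HasWirtinger.sum {ι : Type*} {s : Finset ι} {u : ι → ℂ → ℂ} {A B : ι → ℂ} {z : ℂ}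
    (h : ∀ i ∈ s, HasWirtinger (u i) (A i) (B i) z) :
    HasWirtinger (fun w => ∑ i ∈ s, u i w) (∑ i ∈ s, A i) (∑ i ∈ s, B i) z := by
  refine (HasFDerivAt.fun_sum h).congr_fderiv ?_
  refine ContinuousLinearMap.ext fun t => ?_
  simp [wirtingerCLM_apply, Finset.sum_add_distrib, Finset.sum_mul]

theorem HasWirtinger.div {u v : ℂ → ℂ} {A B C D z : ℂ} (hu : HasWirtinger u A B z)
    (hv : HasWirtinger v C D z) (h0 : v z ≠ 0) :
    HasWirtinger (fun w => u w / v w) ((A * v z - u z * C) / v z ^ 2)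
      ((B * v z - u z * D) / v z ^ 2) z := by
  have hi : HasWirtinger (fun w => (v w)⁻¹) (-C / v z ^ 2) (-D / v z ^ 2) z := by
    refine (((hasDerivAt_inv h0).complexToReal_fderiv).comp z hv).congr_fderiv ?_
    refine ContinuousLinearMap.ext fun t => ?_
    simp [wirtingerCLM_apply]
    ring
  simp only [div_eq_mul_inv (u _)]
  refine (hu.mul hi).congr_coeff ?_ ?_ <;> field_simp <;> ring

/-- The pairing `s ↦ (t ↦ 2 Re (s t))`, which sends `∂_z u` to the differential of a real
function `u`. -/
def twoRePairing : ℂ →L[ℝ] ℂ →L[ℝ] ℝ :=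
  (2 : ℝ) • ((ContinuousLinearMap.compL ℝ ℂ ℂ ℝ Complex.reCLM).comp (ContinuousLinearMap.mul ℝ ℂ))

theorem twoRePairing_apply (s t : ℂ) : twoRePairing s t = 2 * (s * t).re := by
  simp [twoRePairing]

theorem hasWirtinger_ofReal {f : ℂ → ℝ} {s z : ℂ} (h : HasFDerivAt f (twoRePairing s) z) :
    HasWirtinger (fun w => (f w : ℂ)) s (conj s) z := by
  refine (Complex.ofRealCLM.hasFDerivAt.comp z h).congr_fderiv ?_
  refine ContinuousLinearMap.ext fun t => ?_
  simp only [ContinuousLinearMap.comp_apply, twoRePairing_apply, wirtingerCLM_apply,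
    Complex.ofRealCLM_apply]
  rw [← map_mul, Complex.add_conj]

/-- `Δ f = 4 ∂_{conj z} ∂_z f`. -/
theorem laplacian_eq_four_mul {f : ℂ → ℝ} {S : ℂ → ℂ} {A B z : ℂ}
    (hf : ∀ᶠ w in 𝓝 z, HasFDerivAt f (twoRePairing (S w)) w) (hS : HasWirtinger S A B z) :
    Laplacian.laplacian f z = 4 * B.re := by
  rw [InnerProductSpace.laplacian_eq_iteratedFDeriv_complexPlane]
  have h1 : fderiv ℝ f =ᶠ[𝓝 z] fun w => twoRePairing (S w) := by
    filter_upwards [hf] with w hw using hw.fderiv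
  have h2 : fderiv ℝ (fderiv ℝ f) z = twoRePairing.comp (wirtingerCLM A B) := by
    rw [h1.fderiv_eq]
    exact (twoRePairing.hasFDerivAt.comp z hS).fderiv
  simp only [iteratedFDeriv_two_apply, h2]
  simp [twoRePairing_apply, wirtingerCLM_apply]
  ring

end Wirtinger

/-! ### Null vectors in `ℂ³` and the Ahlfors Schwarzian of a real part. -/

section NullVector

/-- The real part of a vector of `ℂ³`. -/
def reVec (Y : Fin 3 → ℂ) : E3 := WithLp.toLp 2 fun i => (Y i).re

theorem inner_reVec (Y Z : Fin 3 → ℂ) :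
    inner ℝ (reVec Y) (reVec Z) = ((∑ i, Y i * conj (Z i)).re + (∑ i, Y i * Z i).re) / 2 := by
  simp only [reVec, PiLp.inner_apply, Complex.re_sum, ← Finset.sum_add_distrib, Finset.sum_div]
  refine Finset.sum_congr rfl fun i _ => ?_
  simp
  ring

/-- The Hermitian square of the part of `Z` orthogonal to `Y` bounds the bilinear square of `Z`,
if `Y` is a null vector with `Y · Z = 0`. -/
theorem norm_sum_sq_le {ι : Type*} [Fintype ι] {Y Z : ι → ℂ} {N : ℝ} (hN : 0 < N)
    (hYY : ∑ i, Y i * conj (Y i) = N) (hY : ∑ i, Y i * Y i = 0) (hYZ : ∑ i, Z i * Y i = 0) :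
    ‖∑ i, Z i * Z i‖ ≤ (∑ i, Z i * conj (Z i)).re - ‖∑ i, Z i * conj (Y i)‖ ^ 2 / N := by
  set a := ∑ i, Z i * conj (Y i) with ha
  have hN' : (N : ℂ) ≠ 0 := by exact_mod_cast hN.ne'
  have hca : ∑ i, Y i * conj (Z i) = conj a := by
    rw [ha, map_sum]
    exact Finset.sum_congr rfl fun i _ => by simp [mul_comm]
  -- Subtracting the Hermitian projection onto `Y` leaves the bilinear square unchanged because `Y ·
  -- Y = Z · Y = 0`, while it lowers the Hermitian square by `|a|² / N`.
  have e1 : ∑ i, Z i * Z i = ∑ i, (Z i - a / N * Y i) * (Z i - a / N * Y i) := by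
    have : ∀ i, (Z i - a / N * Y i) * (Z i - a / N * Y i) =
        Z i * Z i - 2 * (a / N) * (Z i * Y i) + (a / N) ^ 2 * (Y i * Y i) := fun i => by ring
    simp only [this, Finset.sum_add_distrib, Finset.sum_sub_distrib, ← Finset.mul_sum, hY, hYZ]
    ring
  have e2 : ((∑ i, ‖Z i - a / N * Y i‖ ^ 2 : ℝ) : ℂ) = ∑ i, Z i * conj (Z i) - a * conj a / N := by
    have : ∀ i, (((‖Z i - a / N * Y i‖ ^ 2 : ℝ)) : ℂ) = Z i * conj (Z i)
        - conj a / N * (Z i * conj (Y i)) - a / N * (Y i * conj (Z i))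
        + a * conj a / N ^ 2 * (Y i * conj (Y i)) := fun i => by
      rw [Complex.ofReal_pow, ← Complex.mul_conj']
      simp
      ring
    rw [Complex.ofReal_sum]
    simp only [this, Finset.sum_add_distrib, Finset.sum_sub_distrib, ← Finset.mul_sum, hca, hYY,
      ← ha]
    field_simp
    ring
  have e3 : (∑ i, ‖Z i - a / N * Y i‖ ^ 2 : ℝ) =
      (∑ i, Z i * conj (Z i)).re - ‖a‖ ^ 2 / N := by
    have := congrArg Complex.re e2
    rw [Complex.ofReal_re, Complex.sub_re, Complex.mul_conj', ← Complex.ofReal_pow,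
      ← Complex.ofReal_div, Complex.ofReal_re] at this
    exact this
  rw [← e3, e1]
  refine (norm_sum_le _ _).trans (le_of_eq ?_)
  exact Finset.sum_congr rfl fun i _ => by rw [norm_mul, sq]

/-- The Ahlfors Schwarzian of the real part of a null curve is bounded by the Schwarzian of the
lift and the curvature term; `Y, Y₁, Y₂` are the first three derivatives of the null curve. -/
theorem ahlforsSchwarzian_reVec_le {Y Y₁ Y₂ : Fin 3 → ℂ} {N : ℝ} (hN : 0 < N)
    (hYY : ∑ i, Y i * conj (Y i) = N) (h0 : ∑ i, Y i * Y i = 0) (h1 : ∑ i, Y₁ i * Y i = 0)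
    (h2 : ∑ i, Y₁ i * Y₁ i + ∑ i, Y₂ i * Y i = 0) :
    inner ℝ (reVec Y₂) (reVec Y) / ‖reVec Y‖ ^ 2
      - 3 * inner ℝ (reVec Y₁) (reVec Y) ^ 2 / ‖reVec Y‖ ^ 4
      + 3 / 2 * (‖reVec Y₁‖ ^ 2 / ‖reVec Y‖ ^ 2) ≤
    ‖(∑ i, Y₂ i * conj (Y i)) / N - 3 / 2 * (∑ i, Y₁ i * conj (Y i)) ^ 2 / (N : ℂ) ^ 2‖
      + |2 * ((∑ i, Y₁ i * conj (Y₁ i)).re / N - ‖∑ i, Y₁ i * conj (Y i)‖ ^ 2 / N ^ 2)| := by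
  have key := norm_sum_sq_le hN hYY h0 h1
  have hv : ‖reVec Y‖ ^ 2 = N / 2 := by
    rw [← real_inner_self_eq_norm_sq, inner_reVec, hYY, h0]; simp
  have hv4 : ‖reVec Y‖ ^ 4 = N ^ 2 / 4 := by
    rw [show ‖reVec Y‖ ^ 4 = (‖reVec Y‖ ^ 2) ^ 2 by ring, hv]; ring
  have hv1 : ‖reVec Y₁‖ ^ 2 =
      ((∑ i, Y₁ i * conj (Y₁ i)).re + (∑ i, Y₁ i * Y₁ i).re) / 2 := by
    rw [← real_inner_self_eq_norm_sq, inner_reVec]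
  rw [hv4, hv, hv1, inner_reVec, inner_reVec, h1, eq_neg_of_add_eq_zero_right h2]
  set a := ∑ i, Y₁ i * conj (Y i)
  set b := ∑ i, Y₂ i * conj (Y i)
  set m := (∑ i, Y₁ i * conj (Y₁ i)).re
  set d := ∑ i, Y₁ i * Y₁ i
  have hre : (b / N - 3 / 2 * a ^ 2 / (N : ℂ) ^ 2).re = b.re / N - 3 / 2 * (2 * a.re ^ 2
      - ‖a‖ ^ 2) / N ^ 2 := by
    rw [Complex.sub_re, ← Complex.ofReal_pow, Complex.div_ofReal_re, Complex.div_ofReal_re,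
      ← Complex.normSq_eq_norm_sq, Complex.normSq_apply]
    congr 2
    rw [show (3 / 2 : ℂ) = ((3 / 2 : ℝ) : ℂ) by norm_num, Complex.re_ofReal_mul, sq a,
      Complex.mul_re]
    ring
  have hd := (Complex.re_le_norm d).trans key
  refine le_trans ?_ (add_le_add (Complex.re_le_norm _) (le_abs_self _))
  rw [hre, ← sub_nonneg]
  simp only [Complex.neg_re, Complex.zero_re]
  -- Once the modulus is replaced by the real part and the absolute value by its argument, this is
  -- exactly the right side minus the left side.
  have : 0 ≤ (m - ‖a‖ ^ 2 / N - d.re) / (2 * N) := div_nonneg (by linarith) (by positivity)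
  refine this.trans_eq ?_
  field_simp
  ring

end NullVector

/-! ### The lift as the real part of a null curve. -/

section Lift

theorem isOpen_disk : IsOpen disk := Metric.isOpen_ball

theorem mem_disk {z : ℂ} : z ∈ disk ↔ ‖z‖ < 1 := mem_ball_zero_iff

/-- The real linear map `t ↦ Re (t Y)` into `ℝ³`. -/
def reVecCLM (Y : Fin 3 → ℂ) : ℂ →L[ℝ] E3 :=
  ((PiLp.continuousLinearEquiv 2 ℝ (fun _ : Fin 3 => ℝ)).symm : (Fin 3 → ℝ) →L[ℝ] E3).comp
    (ContinuousLinearMap.pi fun i => Complex.reCLM.comp (ContinuousLinearMap.mul ℝ ℂ (Y i)))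

theorem reVecCLM_apply (Y : Fin 3 → ℂ) (t : ℂ) : reVecCLM Y t = reVec fun i => t * Y i := by
  ext i
  simp [reVecCLM, reVec, mul_comm]

/-- `X` is the derivative of a null curve in `ℂ³` whose real part is the lift `F` of `h, g`. -/
structure IsNullLift (h g : ℂ → ℂ) (F : ℂ → E3) (X : Fin 3 → ℂ → ℂ) : Prop where
  differentiableOn : ∀ i, DifferentiableOn ℂ (X i) disk
  null : ∀ z ∈ disk, ∑ i, X i z * X i z = 0
  hermitian : ∀ z ∈ disk, ∑ i, X i z * conj (X i z) = (2 * Real.exp (sigma h g z) ^ 2 : ℝ)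
  hasFDerivAt : ∀ z ∈ disk, HasFDerivAt F (reVecCLM fun i => X i z) z

/-- The components of `F` are the real parts of `h + g`, `-i (h - g)` and `-2 i p`. Nullity is `(h'
+ g')² - (h' - g')² - 4 h' g' = 0`, and the Hermitian square is `2 (|h'| + |g'|)²` because `|p'|² =
|h'| |g'|`. -/
theorem IsWeierstrassEnneperLift.exists_isNullLift {h g : ℂ → ℂ} {F : ℂ → E3}
    (hF : IsWeierstrassEnneperLift h g F) : ∃ X, IsNullLift h g F X := by
  obtain ⟨p, hp, hp2, hFp⟩ := hF.lift
  have dh := hF.analytic_h.deriv isOpen_disk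
  have dg := hF.analytic_g.deriv isOpen_disk
  have dp := hp.deriv isOpen_disk
  refine ⟨![fun z => deriv h z + deriv g z, fun z => -Complex.I * (deriv h z - deriv g z),
    fun z => -2 * Complex.I * deriv p z], ?_, ?_, ?_, ?_⟩
  · intro i
    fin_cases i
    · exact dh.add dg
    · exact (dh.sub dg).const_mul _
    · exact dp.const_mul _
  · intro z hz
    simp only [Fin.sum_univ_three, Matrix.cons_val_zero, Matrix.cons_val_one, Matrix.cons_val]
    linear_combination ((deriv h z - deriv g z) ^ 2 + 4 * deriv p z ^ 2) * Complex.I_mul_I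
      - 4 * hp2 z hz
  · intro z hz
    have h1 : Real.exp (sigma h g z) = ‖deriv h z‖ + ‖deriv g z‖ :=
      Real.exp_log (lt_of_le_of_ne (by positivity) (hF.deriv_ne_zero z hz).symm)
    have h2 : ‖deriv p z‖ ^ 2 = ‖deriv h z‖ * ‖deriv g z‖ := by
      rw [← norm_pow, hp2 z hz, norm_mul]
    have h3 : (deriv p z * conj (deriv p z)) = (‖deriv h z‖ : ℂ) * ‖deriv g z‖ := by
      rw [Complex.mul_conj', ← Complex.ofReal_pow, h2, Complex.ofReal_mul]
    have h4 := Complex.mul_conj' (deriv h z)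
    have h5 := Complex.mul_conj' (deriv g z)
    rw [h1]
    simp only [Fin.sum_univ_three, Matrix.cons_val_zero, Matrix.cons_val_one, Matrix.cons_val,
      map_mul, map_neg, map_sub, map_add, Complex.conj_I]
    have h6 : conj (2 : ℂ) = 2 := Complex.conj_ofNat 2
    rw [h6]
    push_cast
    linear_combination (-((deriv h z - deriv g z) * (conj (deriv h z) - conj (deriv g z)))
      - 4 * (deriv p z * conj (deriv p z))) * Complex.I_mul_I + 4 * h3 + 2 * h4 + 2 * h5
  · intro z hz
    have nz := isOpen_disk.mem_nhds hz
    have eh := ((hF.analytic_h z hz).differentiableAt nz).hasDerivAt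
    have eg := ((hF.analytic_g z hz).differentiableAt nz).hasDerivAt
    have ep := ((hp z hz).differentiableAt nz).hasDerivAt
    have key : ∀ (u : ℂ → ℂ) (a : ℂ), HasDerivAt u a z →
        HasFDerivAt (fun w => (u w).re) (Complex.reCLM.comp (ContinuousLinearMap.mul ℝ ℂ a)) z := by
      intro u a hu
      refine (Complex.reCLM.hasFDerivAt.comp z hu.complexToReal_fderiv).congr_fderiv ?_
      refine ContinuousLinearMap.ext fun t => ?_
      simp
    rw [← hasFDerivWithinAt_univ, hasFDerivWithinAt_euclidean]
    intro i
    rw [hasFDerivWithinAt_univ]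
    fin_cases i
    · refine ((key _ _ (eh.add eg)).congr_of_eventuallyEq ?_).congr_fderiv ?_
      · filter_upwards [nz] with w hw
        simp [hFp w hw]
      · refine ContinuousLinearMap.ext fun t => ?_
        simp [reVecCLM]
        ring
    · refine ((key _ _ ((eh.sub eg).const_mul (-Complex.I))).congr_of_eventuallyEq
        ?_).congr_fderiv ?_
      · filter_upwards [nz] with w hw
        simp [hFp w hw, sub_eq_add_neg]
      · refine ContinuousLinearMap.ext fun t => ?_
        simp [reVecCLM]
        ring
    · refine ((key _ _ (ep.const_mul (-2 * Complex.I))).congr_of_eventuallyEq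
        ?_).congr_fderiv ?_
      · filter_upwards [nz] with w hw
        simp [hFp w hw]
      · refine ContinuousLinearMap.ext fun t => ?_
        simp [reVecCLM]
        ring

variable {h g : ℂ → ℂ} {F : ℂ → E3} {X : Fin 3 → ℂ → ℂ}

theorem IsNullLift.hasDerivAt (hX : IsNullLift h g F X) {z : ℂ} (hz : z ∈ disk) (i : Fin 3) :
    HasDerivAt (X i) (deriv (X i) z) z :=
  ((hX.differentiableOn i z hz).differentiableAt (isOpen_disk.mem_nhds hz)).hasDerivAt

theorem IsNullLift.hasDerivAt_deriv (hX : IsNullLift h g F X) {z : ℂ} (hz : z ∈ disk)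
    (i : Fin 3) : HasDerivAt (deriv (X i)) (deriv (deriv (X i)) z) z :=
  ((((hX.differentiableOn i).deriv isOpen_disk) z hz).differentiableAt
    (isOpen_disk.mem_nhds hz)).hasDerivAt

theorem IsNullLift.sum_deriv_mul (hX : IsNullLift h g F X) {z : ℂ} (hz : z ∈ disk) :
    ∑ i, deriv (X i) z * X i z = 0 := by
  have h1 : HasDerivAt (fun w => ∑ i, X i w * X i w)
      (∑ i, (deriv (X i) z * X i z + X i z * deriv (X i) z)) z :=
    HasDerivAt.fun_sum fun i _ => (hX.hasDerivAt hz i).mul (hX.hasDerivAt hz i)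
  have h2 : HasDerivAt (fun w => ∑ i, X i w * X i w) 0 z := by
    refine (hasDerivAt_const z (0 : ℂ)).congr_of_eventuallyEq ?_
    filter_upwards [isOpen_disk.mem_nhds hz] with w hw using hX.null w hw
  have h3 := h1.unique h2
  have h4 : ∀ i, deriv (X i) z * X i z + X i z * deriv (X i) z = 2 * (deriv (X i) z * X i z) :=
    fun i => by ring
  simp only [h4, ← Finset.mul_sum] at h3
  simpa using h3

theorem IsNullLift.sum_deriv_mul_deriv (hX : IsNullLift h g F X) {z : ℂ} (hz : z ∈ disk) :
    ∑ i, deriv (X i) z * deriv (X i) z + ∑ i, deriv (deriv (X i)) z * X i z = 0 := by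
  have h1 : HasDerivAt (fun w => ∑ i, deriv (X i) w * X i w)
      (∑ i, (deriv (deriv (X i)) z * X i z + deriv (X i) z * deriv (X i) z)) z :=
    HasDerivAt.fun_sum fun i _ => (hX.hasDerivAt_deriv hz i).mul (hX.hasDerivAt hz i)
  have h2 : HasDerivAt (fun w => ∑ i, deriv (X i) w * X i w) 0 z := by
    refine (hasDerivAt_const z (0 : ℂ)).congr_of_eventuallyEq ?_
    filter_upwards [isOpen_disk.mem_nhds hz] with w hw using hX.sum_deriv_mul hw
  have h3 := h1.unique h2
  rw [Finset.sum_add_distrib] at h3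
  rw [add_comm, h3]

/-- The Hermitian product `X' · conj X`. -/
def hermDeriv (X : Fin 3 → ℂ → ℂ) (z : ℂ) : ℂ := ∑ i, deriv (X i) z * conj (X i z)

/-- The Hermitian square `X · conj X`. -/
def hermSq (X : Fin 3 → ℂ → ℂ) (z : ℂ) : ℂ := ∑ i, X i z * conj (X i z)

theorem conj_hermDeriv (X : Fin 3 → ℂ → ℂ) (z : ℂ) :
    conj (hermDeriv X z) = ∑ i, X i z * conj (deriv (X i) z) := by
  simp [hermDeriv, mul_comm]

theorem IsNullLift.hasWirtinger_hermSq (hX : IsNullLift h g F X) {z : ℂ} (hz : z ∈ disk) :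
    HasWirtinger (hermSq X) (hermDeriv X z) (conj (hermDeriv X z)) z := by
  have : ∀ i ∈ Finset.univ, HasWirtinger (fun w => X i w * conj (X i w)) _ _ z := fun i _ =>
    (hasWirtinger_of_hasDerivAt (hX.hasDerivAt hz i)).mul
      (hasWirtinger_of_hasDerivAt (hX.hasDerivAt hz i)).conj
  refine (HasWirtinger.sum this).congr_coeff ?_ ?_
  · simp [hermDeriv]
  · simp [conj_hermDeriv]

theorem IsNullLift.hasWirtinger_hermDeriv (hX : IsNullLift h g F X) {z : ℂ} (hz : z ∈ disk) :
    HasWirtinger (hermDeriv X) (∑ i, deriv (deriv (X i)) z * conj (X i z))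
      (∑ i, deriv (X i) z * conj (deriv (X i) z)) z := by
  have : ∀ i ∈ Finset.univ, HasWirtinger (fun w => deriv (X i) w * conj (X i w)) _ _ z :=
    fun i _ => (hasWirtinger_of_hasDerivAt (hX.hasDerivAt_deriv hz i)).mul
      (hasWirtinger_of_hasDerivAt (hX.hasDerivAt hz i)).conj
  refine (HasWirtinger.sum this).congr_coeff ?_ ?_ <;> simp

theorem IsNullLift.hermSq_eq (hX : IsNullLift h g F X) {z : ℂ} (hz : z ∈ disk) :
    hermSq X z = (2 * Real.exp (sigma h g z) ^ 2 : ℝ) := hX.hermitian z hz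

theorem IsNullLift.hermSq_ne_zero (hX : IsNullLift h g F X) {z : ℂ} (hz : z ∈ disk) :
    hermSq X z ≠ 0 := by
  rw [hX.hermSq_eq hz, Complex.ofReal_ne_zero]
  positivity

/-- On the disk `σ = (log (X · conj X) - log 2) / 2`, which is smooth even where `h'` or `g'`
vanishes. -/
theorem IsNullLift.hasFDerivAt_sigma (hX : IsNullLift h g F X) {z : ℂ} (hz : z ∈ disk) :
    HasFDerivAt (sigma h g) (twoRePairing (hermDeriv X z / (2 * hermSq X z))) z := by
  have hpos : 0 < (hermSq X z).re := by
    rw [hX.hermSq_eq hz, Complex.ofReal_re]; positivity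
  have h1 : HasFDerivAt (fun w => (hermSq X w).re) _ z :=
    Complex.reCLM.hasFDerivAt.comp z (hX.hasWirtinger_hermSq hz)
  have h2 := ((h1.log hpos.ne').sub_const (Real.log 2)).const_mul (1 / 2 : ℝ)
  refine (h2.congr_of_eventuallyEq ?_).congr_fderiv ?_
  · filter_upwards [isOpen_disk.mem_nhds hz] with w hw
    rw [hX.hermSq_eq hw, Complex.ofReal_re, Real.log_mul two_ne_zero (by positivity),
      Real.log_pow, Real.log_exp]
    push_cast
    ring
  · refine ContinuousLinearMap.ext fun t => ?_
    rw [twoRePairing_apply]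
    have hN : hermSq X z = ((hermSq X z).re : ℂ) := by
      rw [hX.hermSq_eq hz, Complex.ofReal_re]
    have e : hermDeriv X z / (2 * hermSq X z) * t =
        ((2 * (hermSq X z).re)⁻¹ : ℝ) * (hermDeriv X z * t) := by
      rw [hN, Complex.ofReal_re]
      push_cast
      ring
    rw [e, Complex.re_ofReal_mul]
    simp only [_root_.smul_apply, ContinuousLinearMap.comp_apply, wirtingerCLM_apply,
      Complex.reCLM_apply, ← map_mul, Complex.add_conj, Complex.ofReal_re, smul_eq_mul]
    field_simp

theorem IsNullLift.dzSigma_eq (hX : IsNullLift h g F X) {z : ℂ} (hz : z ∈ disk) :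
    dzSigma h g z = hermDeriv X z / (2 * hermSq X z) :=
  (hasWirtinger_ofReal (hX.hasFDerivAt_sigma hz)).dz_eq

theorem IsNullLift.hasWirtinger_dzSigma (hX : IsNullLift h g F X) {z : ℂ} (hz : z ∈ disk) :
    HasWirtinger (fun w => hermDeriv X w / (2 * hermSq X w))
      (((∑ i, deriv (deriv (X i)) z * conj (X i z)) * hermSq X z - hermDeriv X z ^ 2) /
        (2 * hermSq X z ^ 2))
      (((∑ i, deriv (X i) z * conj (deriv (X i) z)) * hermSq X z
        - hermDeriv X z * conj (hermDeriv X z)) / (2 * hermSq X z ^ 2)) z := by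
  have hN := hX.hermSq_ne_zero hz
  have h2 := (hasWirtinger_of_hasDerivAt (hasDerivAt_const z (2 : ℂ))).mul
    (hX.hasWirtinger_hermSq hz)
  refine ((hX.hasWirtinger_hermDeriv hz).div h2 (mul_ne_zero two_ne_zero hN)).congr_coeff ?_ ?_
  · field_simp
    ring
  · field_simp
    ring

theorem IsNullLift.schwarzian_eq (hX : IsNullLift h g F X) {z : ℂ} (hz : z ∈ disk) :
    schwarzian h g z = (∑ i, deriv (deriv (X i)) z * conj (X i z)) / hermSq X z
      - 3 / 2 * hermDeriv X z ^ 2 / hermSq X z ^ 2 := by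
  have hN := hX.hermSq_ne_zero hz
  have h1 : HasWirtinger (dzSigma h g) _ _ z :=
    (hX.hasWirtinger_dzSigma hz).congr_of_eventuallyEq (by
      filter_upwards [isOpen_disk.mem_nhds hz] with w hw using hX.dzSigma_eq hw)
  rw [schwarzian, h1.dz_eq, hX.dzSigma_eq hz]
  field_simp
  ring

theorem IsNullLift.laplacian_sigma_eq (hX : IsNullLift h g F X) {z : ℂ} (hz : z ∈ disk) :
    Laplacian.laplacian (sigma h g) z =
      2 * ((∑ i, deriv (X i) z * conj (deriv (X i) z)).re / (2 * Real.exp (sigma h g z) ^ 2)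
        - ‖hermDeriv X z‖ ^ 2 / (2 * Real.exp (sigma h g z) ^ 2) ^ 2) := by
  rw [laplacian_eq_four_mul (f := sigma h g) (by
    filter_upwards [isOpen_disk.mem_nhds hz] with w hw using hX.hasFDerivAt_sigma hw)
    (hX.hasWirtinger_dzSigma hz), Complex.mul_conj', hX.hermSq_eq hz]
  set N := 2 * Real.exp (sigma h g z) ^ 2 with hN
  have hN0 : N ≠ 0 := by positivity
  have e : ((∑ i, deriv (X i) z * conj (deriv (X i) z)) * (N : ℂ) - (‖hermDeriv X z‖ : ℂ) ^ 2) /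
      (2 * (N : ℂ) ^ 2) = ((2 * N ^ 2)⁻¹ : ℝ) * (N * (∑ i, deriv (X i) z * conj (deriv (X i) z))
        - ((‖hermDeriv X z‖ ^ 2 : ℝ) : ℂ)) := by
    push_cast
    ring
  rw [e, Complex.re_ofReal_mul, Complex.sub_re, Complex.re_ofReal_mul, Complex.ofReal_re]
  field_simp
  ring

/-- The restriction of a lift satisfying the Ahlfors-Weill condition to a radius is a Nehari
curve. -/
theorem IsNullLift.isNehariCurve (hX : IsNullLift h g F X) {ρ : ℝ} (hρ : ρ ≤ 1)
    (hAW : AhlforsWeillCondition h g ρ) {η : ℂ} (hη : ‖η‖ = 1) :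
    IsNehariCurve (fun r : ℝ => F (r * η)) (fun r => reVec fun i => η * X i (r * η))
      (fun r => reVec fun i => η ^ 2 * deriv (X i) (r * η))
      (fun r => reVec fun i => η ^ 3 * deriv (deriv (X i)) (r * η)) := by
  have hmem : ∀ r ∈ Ioo (-1 : ℝ) 1, (r * η : ℂ) ∈ disk := by
    intro r hr
    rw [mem_disk, norm_mul, hη, mul_one, Complex.norm_real, Real.norm_eq_abs, abs_lt]
    exact hr
  have dray : ∀ r : ℝ, HasDerivAt (fun t : ℝ => (t * η : ℂ)) η r := fun r => by
    simpa using (Complex.ofRealCLM.hasDerivAt (x := r)).mul_const η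
  have dre : ∀ (Y Y' : Fin 3 → ℝ → ℂ) (r : ℝ), (∀ i, HasDerivAt (Y i) (Y' i r) r) →
      HasDerivAt (fun t => reVec fun i => Y i t) (reVec fun i => Y' i r) r := by
    intro Y Y' r hY
    have h1 : HasDerivAt (fun t => fun i => (Y i t).re) (fun i => (Y' i r).re) r :=
      hasDerivAt_pi.2 fun i => Complex.reCLM.hasFDerivAt.comp_hasDerivAt r (hY i)
    exact ((PiLp.continuousLinearEquiv 2 ℝ (fun _ : Fin 3 => ℝ)).symm :
      (Fin 3 → ℝ) →L[ℝ] E3).hasFDerivAt.comp_hasDerivAt r h1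
  have hη' : η * conj η = 1 := by rw [Complex.mul_conj', hη]; simp
  have herm : ∀ z ∈ disk, ∑ i, η * X i z * conj (η * X i z) =
      (2 * Real.exp (sigma h g z) ^ 2 : ℝ) := by
    intro z hz
    rw [← hX.hermitian z hz]
    refine Finset.sum_congr rfl fun i _ => ?_
    rw [map_mul]
    linear_combination X i z * conj (X i z) * hη'
  have hnull : ∀ z ∈ disk, ∑ i, η * X i z * (η * X i z) = 0 := by
    intro z hz
    rw [← mul_zero (η ^ 2), ← hX.null z hz, Finset.mul_sum]
    exact Finset.sum_congr rfl fun i _ => by ring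
  refine ⟨?_, ?_, ?_, ?_, ?_⟩
  · intro r hr
    have := (hX.hasFDerivAt _ (hmem r hr)).comp_hasDerivAt r (dray r)
    rwa [reVecCLM_apply] at this
  · intro r hr
    refine dre (fun i t => η * X i (t * η)) (fun i t => η ^ 2 * deriv (X i) (t * η)) r fun i => ?_
    exact (((hX.hasDerivAt (hmem r hr) i).comp_of_eq r (dray r) rfl).const_mul η).congr_deriv
      (by ring)
  · intro r hr
    refine dre (fun i t => η ^ 2 * deriv (X i) (t * η))
      (fun i t => η ^ 3 * deriv (deriv (X i)) (t * η)) r fun i => ?_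
    exact (((hX.hasDerivAt_deriv (hmem r hr) i).comp_of_eq r (dray r) rfl).const_mul
      (η ^ 2)).congr_deriv (by ring)
  · intro r hr h0
    have := inner_reVec (fun i => η * X i (r * η)) (fun i => η * X i (r * η))
    rw [h0, herm _ (hmem r hr), hnull _ (hmem r hr), inner_zero_left, Complex.ofReal_re] at this
    have hp : 0 < Real.exp (sigma h g (r * η)) ^ 2 := by positivity
    simp only [Complex.zero_re] at this
    linarith
  · intro r hr
    have hz := hmem r ⟨by linarith [hr.1], hr.2⟩
    set z : ℂ := r * η
    have hNpos : 0 < 2 * Real.exp (sigma h g z) ^ 2 := by positivity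
    refine (ahlforsSchwarzian_reVec_le hNpos (herm z hz) (hnull z hz) ?_ ?_).trans ?_
    · rw [← mul_zero (η ^ 3), ← hX.sum_deriv_mul hz, Finset.mul_sum]
      exact Finset.sum_congr rfl fun i _ => by ring
    · rw [← mul_zero (η ^ 4), ← hX.sum_deriv_mul_deriv hz, mul_add, Finset.mul_sum, Finset.mul_sum]
      congr 1 <;> exact Finset.sum_congr rfl fun i _ => by ring
    · have e1 : ∑ i, η ^ 2 * deriv (X i) z * conj (η * X i z) = η * hermDeriv X z := by
        rw [hermDeriv, Finset.mul_sum]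
        refine Finset.sum_congr rfl fun i _ => ?_
        rw [map_mul]
        linear_combination η * deriv (X i) z * conj (X i z) * hη'
      have e2 : ∑ i, η ^ 3 * deriv (deriv (X i)) z * conj (η * X i z) =
          η ^ 2 * ∑ i, deriv (deriv (X i)) z * conj (X i z) := by
        rw [Finset.mul_sum]
        refine Finset.sum_congr rfl fun i _ => ?_
        rw [map_mul]
        linear_combination η ^ 2 * deriv (deriv (X i)) z * conj (X i z) * hη'
      have e3 : ∑ i, η ^ 2 * deriv (X i) z * conj (η ^ 2 * deriv (X i) z) =
          ∑ i, deriv (X i) z * conj (deriv (X i) z) := by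
        refine Finset.sum_congr rfl fun i _ => ?_
        rw [map_mul, map_pow]
        linear_combination deriv (X i) z * conj (deriv (X i) z) * (η * conj η + 1) * hη'
      have hAW' := hAW z hz
      rw [hX.schwarzian_eq hz, gaussCurvature, hX.laplacian_sigma_eq hz] at hAW'
      rw [e1, e2, e3, norm_mul, hη, one_mul]
      have hnz : ‖z‖ = r := by
        rw [norm_mul, hη, mul_one, Complex.norm_real, Real.norm_of_nonneg hr.1.le]
      have e4 : ‖η ^ 2 * (∑ i, deriv (deriv (X i)) z * conj (X i z)) /
          ((2 * Real.exp (sigma h g z) ^ 2 : ℝ) : ℂ) - 3 / 2 * (η * hermDeriv X z) ^ 2 /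
          ((2 * Real.exp (sigma h g z) ^ 2 : ℝ) : ℂ) ^ 2‖ =
          ‖(∑ i, deriv (deriv (X i)) z * conj (X i z)) / hermSq X z
            - 3 / 2 * hermDeriv X z ^ 2 / hermSq X z ^ 2‖ := by
        rw [← hX.hermSq_eq hz]
        rw [show ∀ a b c : ℂ, η ^ 2 * a / c - 3 / 2 * (η * b) ^ 2 / c ^ 2 =
          η ^ 2 * (a / c - 3 / 2 * b ^ 2 / c ^ 2) by intros; ring]
        rw [norm_mul, norm_pow, hη, one_pow, one_mul]
      rw [e4]
      -- The conformal factor cancels the one in the curvature, so the condition bounds `|S| +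
      -- |Δσ|`.
      rw [abs_mul, abs_neg, Real.abs_exp, ← mul_assoc, ← Real.exp_add,
        show 2 * sigma h g z + -2 * sigma h g z = 0 by ring, Real.exp_zero, one_mul, hnz] at hAW'
      refine hAW'.trans ?_
      gcongr
      linarith

end Lift

/-! ### The circles of the bundle after inversion about `F 0`. -/

/-- A displacement `D⁻¹ U` from the point `y`, where `|U|² = s² D`, stays controlled after the
inversion in the unit sphere about `c`. -/
theorem dist_inversion_add_smul_le {E : Type*} [NormedAddCommGroup E] [InnerProductSpace ℝ E]
    {c y U w : E} {s D β : ℝ} (hs : 0 < s) (hD : 0 < D) (hy : y ≠ c) (hU : ‖U‖ ^ 2 = s ^ 2 * D)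
    (hw : ‖w‖ = s) (hUw : inner ℝ U w = s ^ 2 * β)
    (hpos : 0 < ‖y - c‖ ^ 2 * β + inner ℝ (y - c) w) :
    y + D⁻¹ • U ≠ c ∧ dist (inversion c 1 (y + D⁻¹ • U)) (inversion c 1 y) ≤
      s / (‖y - c‖ ^ 2 * β + inner ℝ (y - c) w) := by
  set x := y - c with hx
  have hx0 : 0 < ‖x‖ := norm_pos_iff.2 (sub_ne_zero.2 hy)
  set l := ‖x‖ ^ 2 * β + inner ℝ x w with hl
  have hb : y + D⁻¹ • U - c = x + D⁻¹ • U := by rw [hx]; abel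
  have e1 : ‖x + D⁻¹ • U‖ ^ 2 = ‖x‖ ^ 2 + 2 * (inner ℝ x U / D) + s ^ 2 / D := by
    rw [norm_add_sq_real, real_inner_smul_right, norm_smul, mul_pow, hU, Real.norm_of_nonneg
      (by positivity)]
    field_simp
  -- This vector has length proportional to `|x + D⁻¹ U|`, the distance to the center that enters
  -- the inversion formula; pairing it with `w` bounds that length from below by `s l`.
  have e2 : ‖(‖x‖ ^ 2) • U + (s ^ 2) • x‖ ^ 2 = ‖x‖ ^ 2 * s ^ 2 * D * ‖x + D⁻¹ • U‖ ^ 2 := by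
    rw [e1, norm_add_sq_real, real_inner_smul_right, real_inner_smul_left, norm_smul, norm_smul,
      mul_pow, mul_pow, hU, Real.norm_of_nonneg (by positivity), Real.norm_of_nonneg
      (by positivity), real_inner_comm U x]
    field_simp
  have e3 : s ^ 2 * l = inner ℝ ((‖x‖ ^ 2) • U + (s ^ 2) • x) w := by
    rw [inner_add_left, real_inner_smul_left, real_inner_smul_left, hUw, hl]
    ring
  have e4 : s ^ 2 * l ≤ ‖(‖x‖ ^ 2) • U + (s ^ 2) • x‖ * s := by
    rw [e3, ← hw]
    exact real_inner_le_norm _ _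
  have e5 : s * l ≤ ‖(‖x‖ ^ 2) • U + (s ^ 2) • x‖ := by
    have : s * (s * l) ≤ s * ‖(‖x‖ ^ 2) • U + (s ^ 2) • x‖ := by linarith
    exact le_of_mul_le_mul_left this hs
  have e6 : l ^ 2 ≤ ‖x‖ ^ 2 * D * ‖x + D⁻¹ • U‖ ^ 2 := by
    have h1 := pow_le_pow_left₀ (by positivity) e5 2
    rw [e2, mul_pow] at h1
    have : s ^ 2 * l ^ 2 ≤ s ^ 2 * (‖x‖ ^ 2 * D * ‖x + D⁻¹ • U‖ ^ 2) := by linarith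
    exact le_of_mul_le_mul_left this (by positivity)
  have hne : y + D⁻¹ • U ≠ c := by
    intro h
    rw [← hb, h, sub_self, norm_zero] at e6
    have : 0 < l ^ 2 := by positivity
    norm_num at e6
    linarith
  refine ⟨hne, ?_⟩
  have hV : 0 < ‖x + D⁻¹ • U‖ := by
    rw [← hb]; exact norm_pos_iff.2 (sub_ne_zero.2 hne)
  rw [EuclideanGeometry.dist_inversion_inversion hne hy, dist_eq_norm, dist_eq_norm, dist_eq_norm,
    hb, ← hx, add_sub_cancel_left, norm_smul, Real.norm_of_nonneg (by positivity)]
  rw [one_pow, one_div_mul_eq_div, div_le_div_iff₀ (by positivity) hpos]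
  refine le_of_sq_le_sq ?_ (by positivity)
  have : (D⁻¹ * ‖U‖ * l) ^ 2 = s ^ 2 / D * l ^ 2 := by
    rw [mul_pow, mul_pow, hU]
    field_simp
  rw [this]
  calc s ^ 2 / D * l ^ 2 ≤ s ^ 2 / D * (‖x‖ ^ 2 * D * ‖x + D⁻¹ • U‖ ^ 2) := by gcongr
    _ = _ := by field_simp

/-- The inverse of the inversion in the unit sphere about `c`, extended to the center by `∞`. -/
def uninvert (c y : E3) : OnePoint E3 :=
  open Classical in if y = c then OnePoint.infty else (inversion c 1 y : E3)

theorem uninvert_self (c : E3) : uninvert c c = OnePoint.infty := by simp [uninvert]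

theorem uninvert_inversion {c y : E3} (hy : y ≠ c) :
    uninvert c (inversion c 1 y) = (y : OnePoint E3) := by
  rw [uninvert, if_neg, EuclideanGeometry.inversion_inversion c one_ne_zero]
  rwa [EuclideanGeometry.inversion_eq_center one_ne_zero]

theorem exists_of_mem_diskCircle {z : ℂ} (hz : z ≠ 0) {p : OnePoint E3} (hp : p ∈ diskCircle z) :
    ∃ (u : E3) (s : ℝ), p = u ∧ u 0 = s * z.re ∧ u 1 = s * z.im ∧
      (s - 1) * (s * ‖z‖ ^ 2 - 1) + u 2 ^ 2 = 0 := by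
  rw [diskCircle, if_neg hz] at hp
  obtain ⟨u, ⟨⟨s, hs⟩, hu⟩, rfl⟩ := hp
  have h0 : u 0 = s * z.re := by simpa using congrArg Complex.re hs
  have h1 : u 1 = s * z.im := by simpa using congrArg Complex.im hs
  refine ⟨u, s, rfl, h0, h1, ?_⟩
  have hz2 : z.re ^ 2 + z.im ^ 2 ≠ 0 := by
    have := Complex.normSq_pos.2 hz
    rw [Complex.normSq_apply, ← sq, ← sq] at this
    exact this.ne'
  rw [PiLp.inner_apply, Fin.sum_univ_three] at hu
  simp [embed, h0, h1, Complex.inv_re, Complex.inv_im, Complex.normSq_apply, ← sq]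
    at hu
  rw [← Complex.normSq_eq_norm_sq, Complex.normSq_apply, ← sq, ← sq, ← hu]
  field_simp

/-- The finite part of the image of a point of `diskCircle z` under the first two steps of the
best Möbius approximation. -/
theorem spaceM_of_mem_diskCircle (h g : ℂ → ℂ) {z : ℂ} (hz : z ∈ disk) (hz0 : z ≠ 0)
    {p : OnePoint E3} (hp : p ∈ diskCircle z) :
    spaceM h g z p = ((0 : E3) : OnePoint E3) ∨
    ∃ τ : ℝ, spaceM h g z p = spaceInv ((!₂[(conj z / (1 - ‖z‖ ^ 2) - dzSigma h g z).re,
      (conj z / (1 - ‖z‖ ^ 2) - dzSigma h g z).im, τ] : E3) : OnePoint E3) := by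
  obtain ⟨u, s, rfl, h0, h1, h2⟩ := exists_of_mem_diskCircle hz0 hp
  have hlt : 0 < 1 - ‖z‖ ^ 2 := by
    have := mem_disk.1 hz
    nlinarith [norm_nonneg z]
  by_cases hu : u = embed z
  · left
    subst hu
    simp [spaceM, spaceInv]
  · right
    have hq : u - embed z ≠ 0 := sub_ne_zero.2 hu
    have q0 : (u - embed z) 0 = (s - 1) * z.re := by simp [embed, h0]; ring
    have q1 : (u - embed z) 1 = (s - 1) * z.im := by simp [embed, h1]; ring
    have q2 : (u - embed z) 2 = u 2 := by simp [embed]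
    -- On the circle the squared distance from `z` is a multiple of `s - 1`, as is the horizontal
    -- displacement. Their quotient is constant, so inversion at `z` gives a vertical line, over `1
    -- / (z* - z) = conj z / (1 - |z|²)`.
    have hn : ‖u - embed z‖ ^ 2 = (s - 1) * (1 - ‖z‖ ^ 2) := by
      rw [EuclideanSpace.norm_sq_eq, Fin.sum_univ_three, q0, q1, q2]
      simp only [Real.norm_eq_abs, sq_abs]
      have := Complex.normSq_eq_norm_sq z
      rw [Complex.normSq_apply] at this
      linear_combination h2 + (s - 1) ^ 2 * this
    have hs : s - 1 ≠ 0 := by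
      intro hs
      rw [hs, zero_mul] at hn
      exact hq (norm_eq_zero.1 (pow_eq_zero_iff two_ne_zero |>.1 hn))
    refine ⟨((s - 1) * (1 - ‖z‖ ^ 2))⁻¹ * u 2, ?_⟩
    unfold spaceM
    congr 1
    have : OnePoint.map (fun u => u - embed z) (u : OnePoint E3) = ((u - embed z : E3)) := rfl
    rw [this]
    have : spaceInv ((u - embed z : E3) : OnePoint E3) = (((‖u - embed z‖ ^ 2)⁻¹ •
      (!₂[(u - embed z) 0, -(u - embed z) 1, (u - embed z) 2] : E3) : E3) : OnePoint E3) := by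
      show (if u - embed z = 0 then _ else _) = _
      rw [if_neg hq]
    rw [this, hn, q0, q1, q2, OnePoint.map_some]
    congr 1
    have ec : (conj z / (1 - (‖z‖ : ℂ) ^ 2)) = ((1 - ‖z‖ ^ 2)⁻¹ : ℝ) * conj z := by
      push_cast
      ring
    have hlt' := hlt.ne'
    ext i
    fin_cases i
    · simp only [ec, Complex.sub_re, Complex.re_ofReal_mul, Complex.conj_re]
      simp [embed]
      field_simp
    · simp only [ec, Complex.sub_im, Complex.im_ofReal_mul, Complex.conj_im]
      simp [embed]
      field_simp
    · simp [embed]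

variable {h g : ℂ → ℂ} {F : ℂ → E3} {X : Fin 3 → ℂ → ℂ}

theorem IsNullLift.fderiv_apply (hX : IsNullLift h g F X) {z : ℂ} (hz : z ∈ disk) (t : ℂ) :
    fderiv ℝ F z t = reVec fun i => t * X i z := by
  rw [(hX.hasFDerivAt z hz).fderiv, reVecCLM_apply]

/-- The lift is conformal. -/
theorem IsNullLift.inner_fderiv (hX : IsNullLift h g F X) {z : ℂ} (hz : z ∈ disk) (t t' : ℂ) :
    inner ℝ (fderiv ℝ F z t) (fderiv ℝ F z t') = Real.exp (sigma h g z) ^ 2 * (t * conj t').re := by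
  rw [hX.fderiv_apply hz, hX.fderiv_apply hz, inner_reVec]
  have e1 : ∑ i, t * X i z * conj (t' * X i z) =
      (2 * Real.exp (sigma h g z) ^ 2 : ℝ) * (t * conj t') := by
    rw [← hX.hermitian z hz, Finset.sum_mul]
    refine Finset.sum_congr rfl fun i _ => ?_
    rw [map_mul]
    ring
  have e2 : ∑ i, t * X i z * (t' * X i z) = 0 := by
    rw [← mul_zero (t * t'), ← hX.null z hz, Finset.mul_sum]
    exact Finset.sum_congr rfl fun i _ => by ring
  rw [e1, e2, Complex.re_ofReal_mul]
  simp
  ring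

theorem IsNullLift.norm_fderiv (hX : IsNullLift h g F X) {z : ℂ} (hz : z ∈ disk) {t : ℂ}
    (ht : ‖t‖ = 1) : ‖fderiv ℝ F z t‖ = Real.exp (sigma h g z) := by
  have h1 := hX.inner_fderiv hz t t
  rw [real_inner_self_eq_norm_sq, Complex.mul_conj', ht] at h1
  exact (pow_left_inj₀ (norm_nonneg _) (by positivity) two_ne_zero).1 (by simpa using h1)

/-- The lower bound for the gradient of the weighted distance from `F 0`, in the form in which it
controls the reflection. -/
theorem IsNullLift.slope_lower_bound (hX : IsNullLift h g F X) {ρ : ℝ} (hρ : ρ ≤ 1)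
    (hAW : AhlforsWeillCondition h g ρ) {r : ℝ} (hr : r ∈ Ioo (0 : ℝ) 1) {η : ℂ} (hη : ‖η‖ = 1) :
    F (r * η) ≠ F 0 ∧
    Real.exp (sigma h g 0) * hypDist r * Real.exp (sigma h g (r * η)) ≤
      ‖F (r * η) - F 0‖ ^ 2 * ((conj (r * η) / (1 - ‖(r * η : ℂ)‖ ^ 2)
        - dzSigma h g (r * η)) * η).re
      + inner ℝ (F (r * η) - F 0) (fderiv ℝ F (r * η) η) := by
  have hc := hX.isNehariCurve hρ hAW hη
  have hnr : ‖(r * η : ℂ)‖ = r := by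
    rw [norm_mul, hη, mul_one, Complex.norm_real, Real.norm_of_nonneg hr.1.le]
  have hz : (r * η : ℂ) ∈ disk := by rw [mem_disk, hnr]; exact hr.2
  have h0 : (0 : ℂ) ∈ disk := by simp [mem_disk]
  have hF0 : F ((0 : ℝ) * η) = F 0 := by simp
  have hne := hc.ne_initial hr
  have hA := hc.le_curveSlope hr
  have hW := hc.le_curveWeight hr
  have hv0 : ‖reVec fun i => η * X i ((0 : ℝ) * η)‖ = Real.exp (sigma h g 0) := by
    rw [← hX.norm_fderiv h0 hη, hX.fderiv_apply h0]; simp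
  have hL := hypDist_pos hr.1 hr.2
  have h1 : 0 < 1 - r ^ 2 := by nlinarith [hr.1, hr.2]
  rw [hv0] at hA hW
  simp only [hF0] at hne
  refine ⟨hne, ?_⟩
  have hx := norm_pos_iff.2 (sub_ne_zero.2 hne)
  have hv : ‖reVec fun i => η * X i (r * η)‖ = Real.exp (sigma h g (r * η)) := by
    rw [← hX.norm_fderiv hz hη, hX.fderiv_apply hz]
  -- In the product of the two bounds the weight occurs squared, which removes the square roots of
  -- the conformal factor.
  have hmul := mul_le_mul hW hA (by positivity) (le_trans (by positivity) hW)
  have hsq := Real.mul_self_sqrt (Real.exp_pos (sigma h g 0)).le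
  have hlhs : √(Real.exp (sigma h g 0)) * hypDist r * √(Real.exp (sigma h g 0)) =
      Real.exp (sigma h g 0) * hypDist r := by
    linear_combination hypDist r * hsq
  rw [hlhs] at hmul
  have hη' : η * conj η = 1 := by rw [Complex.mul_conj', hη]; simp
  have hinner : inner ℝ (reVec fun i => η ^ 2 * deriv (X i) (r * η))
      (reVec fun i => η * X i (r * η)) = (η * hermDeriv X (r * η)).re / 2 := by
    rw [inner_reVec]
    have e1 : ∑ i, η ^ 2 * deriv (X i) (r * η) * conj (η * X i (r * η)) =
        η * hermDeriv X (r * η) := by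
      rw [hermDeriv, Finset.mul_sum]
      refine Finset.sum_congr rfl fun i _ => ?_
      rw [map_mul]
      linear_combination η * deriv (X i) (r * η) * conj (X i (r * η)) * hη'
    have e2 : ∑ i, η ^ 2 * deriv (X i) (r * η) * (η * X i (r * η)) = 0 := by
      rw [← mul_zero (η ^ 3), ← hX.sum_deriv_mul hz, Finset.mul_sum]
      exact Finset.sum_congr rfl fun i _ => by ring
    rw [e1, e2]
    simp
  set S := Real.exp (sigma h g (r * η)) with hS
  have hSpos : 0 < S := Real.exp_pos _
  have hβ : ((conj (r * η) / (1 - ‖(r * η : ℂ)‖ ^ 2) - dzSigma h g (r * η)) * η).re =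
      r / (1 - r ^ 2) - 1 / 2 * ((η * hermDeriv X (r * η)).re / 2 / S ^ 2) := by
    rw [hnr, hX.dzSigma_eq hz, hX.hermSq_eq hz, ← hS]
    have : (conj (r * η : ℂ) / (1 - (r : ℂ) ^ 2) -
        hermDeriv X (r * η) / (2 * ((2 * S ^ 2 : ℝ) : ℂ))) * η =
        ((r / (1 - r ^ 2) : ℝ) : ℂ) - ((4 * S ^ 2)⁻¹ : ℝ) * (η * hermDeriv X (r * η)) := by
      rw [map_mul, Complex.conj_ofReal]
      push_cast
      linear_combination (r / (1 - (r : ℂ) ^ 2)) * hη'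
    rw [this, Complex.sub_re, Complex.re_ofReal_mul, Complex.ofReal_re]
    field_simp
    ring
  rw [hβ, hX.fderiv_apply hz]
  simp only [curveSlope, curveWeight, curveLogDeriv, hF0] at hmul
  rw [hinner, hv] at hmul
  have hss : √(S * (1 - r ^ 2)) ^ 2 = S * (1 - r ^ 2) := Real.sq_sqrt (by positivity)
  have hsp : 0 < √(S * (1 - r ^ 2)) := by positivity
  have hmul2 := mul_le_mul_of_nonneg_right hmul hSpos.le
  refine hmul2.trans_eq ?_
  set q := √(S * (1 - r ^ 2))
  have h1' := h1.ne'
  have e : ∀ n l : ℝ, n / q * ((1 - r ^ 2) * (n / q * l)) * S = n ^ 2 * l := by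
    intro n l
    field_simp
    rw [hss]
    ring
  rw [e]
  field_simp
  ring

/-- Every point of the circle of the bundle over `F z` is close to `F z` after the inversion about
`F 0`. -/
theorem IsNullLift.exists_uninvert_eq (hX : IsNullLift h g F X) {ρ : ℝ} (hρ : ρ ≤ 1)
    (hAW : AhlforsWeillCondition h g ρ) {z : ℂ} (hz : z ∈ disk) (hz0 : z ≠ 0) {p : OnePoint E3}
    (hp : p ∈ diskCircle z) :
    ∃ y, bestMobius h g F p z = uninvert (F 0) y ∧
      dist y (inversion (F 0) 1 (F z)) ≤ (Real.exp (sigma h g 0) * hypDist ‖z‖)⁻¹ := by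
  have hr : ‖z‖ ∈ Ioo (0 : ℝ) 1 := ⟨norm_pos_iff.2 hz0, mem_disk.1 hz⟩
  set η : ℂ := z / ‖z‖ with hηdef
  have hzn : (‖z‖ : ℂ) ≠ 0 := by exact_mod_cast hr.1.ne'
  have hη : ‖η‖ = 1 := by
    rw [hηdef, norm_div, Complex.norm_real, norm_norm, div_self hr.1.ne']
  have hzη : (‖z‖ : ℂ) * η = z := by rw [hηdef]; field_simp
  obtain ⟨hne, hlow⟩ := hX.slope_lower_bound hρ hAW hr hη
  rw [hzη] at hne hlow
  set S := Real.exp (sigma h g z) with hS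
  have hSpos : 0 < S := Real.exp_pos _
  set c := Real.exp (sigma h g 0) * hypDist ‖z‖ with hcdef
  have hcpos : 0 < c := mul_pos (Real.exp_pos _) (hypDist_pos hr.1 hr.2)
  set B := conj z / (1 - (‖z‖ : ℂ) ^ 2) - dzSigma h g z with hB
  set l := ‖F z - F 0‖ ^ 2 * (B * η).re + inner ℝ (F z - F 0) (fderiv ℝ F z η) with hl
  have hlpos : 0 < l := lt_of_lt_of_le (by positivity) hlow
  have hSl : S / l ≤ c⁻¹ := by
    rw [div_le_iff₀ hlpos, inv_mul_eq_div, le_div_iff₀ hcpos]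
    linarith
  have hx0 : 0 < ‖F z - F 0‖ := norm_pos_iff.2 (sub_ne_zero.2 hne)
  rcases spaceM_of_mem_diskCircle h g hz hz0 hp with hM | ⟨τ, hM⟩
  · refine ⟨_, ?_, (dist_self _).trans_le (inv_nonneg.2 hcpos.le)⟩
    rw [uninvert_inversion hne, bestMobius, hM, OnePoint.map_some]
    simp [tangentFrame]
  · rw [← hB] at hM
    set v : E3 := !₂[B.re, B.im, τ] with hv
    by_cases hv0 : v = 0
    -- This point of the circle is `∞`, which corresponds to the center `F 0`. Here `B = 0`, so `l ≤
    -- |F z - F 0| e^σ`, which is the required bound.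
    · refine ⟨F 0, ?_, ?_⟩
      · have : spaceInv (v : OnePoint E3) = OnePoint.infty := by
          show (if v = 0 then _ else _) = _
          rw [if_pos hv0]
        rw [uninvert_self, bestMobius, hM, this]
        rfl
      · have b0 : B.re = 0 := by simpa [hv] using congrArg (fun w : E3 => w 0) hv0
        have b1 : B.im = 0 := by simpa [hv] using congrArg (fun w : E3 => w 1) hv0
        have hBz : B = 0 := Complex.ext b0 b1
        rw [EuclideanGeometry.dist_center_inversion, dist_comm, dist_eq_norm]
        refine le_trans ?_ hSl
        rw [one_pow, div_le_div_iff₀ hx0 hlpos, one_mul, hl, hBz, zero_mul, Complex.zero_re,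
          mul_zero, zero_add]
        have := real_inner_le_norm (F z - F 0) (fderiv ℝ F z η)
        rw [hX.norm_fderiv hz hη] at this
        linarith
    · set D := ‖v‖ ^ 2 with hDdef
      have hD : 0 < D := by have := norm_pos_iff.2 hv0; positivity
      have hDeq : D = B.re ^ 2 + B.im ^ 2 + τ ^ 2 := by
        rw [hDdef, EuclideanSpace.norm_sq_eq, Fin.sum_univ_three]
        simp [hv]
      set fx := fderiv ℝ F z 1 with hfx
      set fy := fderiv ℝ F z Complex.I with hfy
      -- Together with `fx` and `fy` this is an orthogonal frame of vectors of common length `S`,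
      -- hence `|U|² = S² D`.
      set n : E3 := S⁻¹ • WithLp.toLp 2 (crossProduct (WithLp.ofLp fx) (WithLp.ofLp fy)) with hn
      have xx : inner ℝ fx fx = S ^ 2 := by rw [hX.inner_fderiv hz]; simp [hS]
      have yy : inner ℝ fy fy = S ^ 2 := by rw [hX.inner_fderiv hz]; simp [hS]
      have xy : inner ℝ fx fy = 0 := by rw [hX.inner_fderiv hz]; simp
      have dot : ∀ a b : E3, inner ℝ a b = WithLp.ofLp a ⬝ᵥ WithLp.ofLp b := by
        intro a b
        rw [EuclideanSpace.inner_eq_star_dotProduct, dotProduct_comm]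
        simp
      have nx : inner ℝ n fx = 0 := by
        rw [hn, real_inner_smul_left, real_inner_comm, dot]
        simp [dot_self_cross]
      have ny : inner ℝ n fy = 0 := by
        rw [hn, real_inner_smul_left, real_inner_comm, dot]
        simp [dot_cross_self]
      have nn : inner ℝ n n = S ^ 2 := by
        have hc := cross_dot_cross (WithLp.ofLp fx) (WithLp.ofLp fy) (WithLp.ofLp fx)
          (WithLp.ofLp fy)
        rw [← dot fx fx, ← dot fy fy, ← dot fx fy, xx, yy, xy] at hc
        rw [hn, real_inner_smul_left, real_inner_smul_right, dot, hc]
        field_simp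
        ring
      set U : E3 := B.re • fx + (-B.im) • fy + τ • n with hU
      have hmob : bestMobius h g F p z = ((F z + D⁻¹ • U : E3) : OnePoint E3) := by
        have : spaceInv (v : OnePoint E3) = ((D⁻¹ • (!₂[v 0, -v 1, v 2] : E3) : E3)) := by
          show (if v = 0 then _ else _) = _
          rw [if_neg hv0]
        rw [bestMobius, hM, this, OnePoint.map_some]
        congr 1
        rw [tangentFrame, Real.exp_neg, ← hS, ← hfx, ← hfy, ← hn, hU]
        simp [hv, smul_add, smul_smul, add_assoc]
      have hUn : ‖U‖ ^ 2 = S ^ 2 * D := by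
        have hyx : inner ℝ fy fx = 0 := by rw [real_inner_comm, xy]
        have xn : inner ℝ fx n = 0 := by rw [real_inner_comm, nx]
        have yn : inner ℝ fy n = 0 := by rw [real_inner_comm, ny]
        rw [← real_inner_self_eq_norm_sq, hU, hDeq]
        simp only [inner_add_left, inner_add_right, real_inner_smul_left, real_inner_smul_right,
          xx, yy, xy, nx, ny, nn, hyx, xn, yn]
        ring
      have hUw : inner ℝ U (fderiv ℝ F z η) = S ^ 2 * (B * η).re := by
        have hfη : fderiv ℝ F z η = η.re • fx + η.im • fy := by
          rw [hfx, hfy, ← map_smul, ← map_smul, ← map_add]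
          congr 1
          apply Complex.ext <;> simp
        have hyx : inner ℝ fy fx = 0 := by rw [real_inner_comm, xy]
        rw [hfη, hU, Complex.mul_re]
        simp only [inner_add_left, inner_add_right, real_inner_smul_left, real_inner_smul_right,
          xx, yy, xy, nx, ny, hyx]
        ring
      obtain ⟨h1, h2⟩ := dist_inversion_add_smul_le hSpos hD hne hUn (hX.norm_fderiv hz hη) hUw
        hlpos
      exact ⟨_, by rw [hmob, uninvert_inversion h1], h2.trans hSl⟩

/-! ### Boundary limits of the lift and of the circles. -/

theorem continuous_uninvert (c : E3) : Continuous (uninvert c) := by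
  rw [continuous_iff_continuousAt]
  intro y
  by_cases hy : y = c
  · subst hy
    rw [ContinuousAt, uninvert_self, ← nhdsNE_sup_pure, tendsto_sup]
    refine ⟨?_, ?_⟩
    · have h1 := EuclideanGeometry.tendsto_inversion_nhdsNE_center_cobounded (c := y)
        (one_ne_zero : (1 : ℝ) ≠ 0)
      rw [Metric.cobounded_eq_cocompact, ← coclosedCompact_eq_cocompact] at h1
      refine (OnePoint.tendsto_coe_infty.comp h1).congr' ?_
      filter_upwards [self_mem_nhdsWithin] with w hw
      have : w ≠ y := hw
      simp [uninvert, this]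
    · refine (tendsto_pure_nhds (fun w => uninvert y w) y).trans ?_
      rw [uninvert_self]
  · have h1 : ContinuousAt (fun w => ((inversion c 1 w : E3) : OnePoint E3)) y :=
      OnePoint.continuous_coe.continuousAt.comp
        (continuousAt_const.inversion continuousAt_const continuousAt_id hy)
    refine h1.congr ?_
    filter_upwards [isOpen_ne.mem_nhds hy] with w hw
    have : w ≠ c := hw
    simp [uninvert, this]

theorem mem_closure_disk {ζ : ℂ} (hζ : ζ ∈ circle) : ζ ∈ closure disk := by
  rw [disk, closure_ball 0 one_ne_zero]
  exact Metric.sphere_subset_closedBall hζ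

theorem norm_eq_of_mem_circle {ζ : ℂ} (hζ : ζ ∈ circle) : ‖ζ‖ = 1 := mem_sphere_zero_iff_norm.1 hζ

theorem tendsto_norm_nhdsWithin_disk {ζ₀ : ℂ} (hζ₀ : ζ₀ ∈ circle) :
    Tendsto (fun z : ℂ => ‖z‖) (𝓝[disk] ζ₀) (𝓝[<] 1) := by
  refine tendsto_nhdsWithin_iff.2 ⟨?_, ?_⟩
  · rw [← norm_eq_of_mem_circle hζ₀]
    exact continuous_norm.continuousAt.tendsto.mono_left nhdsWithin_le_nhds
  · filter_upwards [self_mem_nhdsWithin] with z hz using mem_disk.1 hz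

theorem tendsto_inv_mul_hypDist {c : ℝ} (hc : 0 < c) :
    Tendsto (fun r => (c * hypDist r)⁻¹) (𝓝[<] 1) (𝓝 0) :=
  (tendsto_hypDist.const_mul_atTop hc).inv_tendsto_atTop

/-- The lift inverted about `F 0` has boundary values. -/
theorem IsNullLift.exists_tendsto_inversion (hX : IsNullLift h g F X) {ρ : ℝ} (hρ : ρ ≤ 1)
    (hAW : AhlforsWeillCondition h g ρ) {ζ₀ : ℂ} (hζ₀ : ζ₀ ∈ circle) :
    ∃ y, Tendsto (fun z => inversion (F 0) 1 (F z)) (𝓝[disk] ζ₀) (𝓝 y) := by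
  have hζn := norm_eq_of_mem_circle hζ₀
  have h0 : (0 : ℂ) ∈ disk := by simp [mem_disk]
  set c := Real.exp (sigma h g 0) with hc
  have hcpos : 0 < c := Real.exp_pos _
  set G : ℂ → E3 := fun z => inversion (F 0) 1 (F z) with hG
  have := mem_closure_iff_nhdsWithin_neBot.1 (mem_closure_disk hζ₀)
  refine cauchy_map_iff_exists_tendsto.1 (Metric.cauchy_iff.2 ⟨inferInstance, fun ε hε => ?_⟩)
  have hsmall : ∀ᶠ r in 𝓝[<] (1 : ℝ), (c * hypDist r)⁻¹ < ε / 4 :=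
    (tendsto_inv_mul_hypDist hcpos).eventually (gt_mem_nhds (by positivity))
  -- At this radius moving further outward costs less than `ε / 4` in every direction at once, so
  -- only continuity of the lift at the interior point `r ζ₀` remains to be used.
  obtain ⟨r, hr, hrI⟩ := (hsmall.and (Ioo_mem_nhdsLT (show (0 : ℝ) < 1 by norm_num))).exists
  have hrζ : (r * ζ₀ : ℂ) ∈ disk := by
    rw [mem_disk, norm_mul, hζn, mul_one, Complex.norm_real, Real.norm_of_nonneg hrI.1.le]
    exact hrI.2
  have hcont : ContinuousAt (fun z : ℂ => G (r * (z / ‖z‖))) ζ₀ := by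
    have e : (r * (ζ₀ / ‖ζ₀‖) : ℂ) = r * ζ₀ := by rw [hζn]; simp
    have h1 : ContinuousAt (fun z : ℂ => (r * (z / ‖z‖) : ℂ)) ζ₀ := by
      refine continuousAt_const.mul (continuousAt_id.div ?_ ?_)
      · exact (Complex.continuous_ofReal.comp continuous_norm).continuousAt
      · rw [hζn]; simp
    have h2 : ContinuousAt F (r * (ζ₀ / ‖ζ₀‖)) := by
      rw [e]; exact (hX.hasFDerivAt _ hrζ).continuousAt
    refine ContinuousAt.inversion continuousAt_const continuousAt_const
      (ContinuousAt.comp (f := fun z : ℂ => (r * (z / ‖z‖) : ℂ)) h2 h1) ?_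
    show F (r * (ζ₀ / ‖ζ₀‖)) ≠ F 0
    rw [e]
    exact (hX.slope_lower_bound hρ hAW hrI hζn).1
  have hnear : ∀ᶠ z in 𝓝[disk] ζ₀, dist (G z) (G (r * (ζ₀ / ‖ζ₀‖))) < ε / 2 := by
    have h1 := nhdsWithin_le_nhds (s := disk) (hcont.eventually (Metric.ball_mem_nhds _
      (show 0 < ε / 4 by positivity)))
    have h2 : ∀ᶠ z in 𝓝[disk] ζ₀, r < ‖z‖ := (tendsto_norm_nhdsWithin_disk hζ₀).eventually
      (nhdsWithin_le_nhds (lt_mem_nhds hrI.2))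
    filter_upwards [h1, h2, self_mem_nhdsWithin] with z hz1 hz2 hzd
    have hzpos : 0 < ‖z‖ := hrI.1.trans hz2
    have hzc : (‖z‖ : ℂ) ≠ 0 := by exact_mod_cast hzpos.ne'
    have hη : ‖z / (‖z‖ : ℂ)‖ = 1 := by
      rw [norm_div, Complex.norm_real, norm_norm, div_self hzpos.ne']
    have hcurve := hX.isNehariCurve hρ hAW hη
    have h3 := hcurve.dist_inversion_le hrI.1 hz2.le (mem_disk.1 hzd)
    have hv0 : ‖reVec fun i => z / ‖z‖ * X i ((0 : ℝ) * (z / ‖z‖))‖ = c := by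
      rw [hc, ← hX.norm_fderiv h0 hη, hX.fderiv_apply h0]; simp
    have e1 : (‖z‖ : ℂ) * (z / ‖z‖) = z := by field_simp
    have e2 : F ((0 : ℝ) * (z / ‖z‖)) = F 0 := by simp
    simp only [hv0, e1, e2] at h3
    have h4 := dist_triangle (G z) (G (r * (z / ‖z‖))) (G (r * (ζ₀ / ‖ζ₀‖)))
    have h5 : dist (G (r * (z / ‖z‖))) (G (r * (ζ₀ / ‖ζ₀‖))) < ε / 4 := hz1
    have h6 : dist (G z) (G (r * (z / ‖z‖))) ≤ (c * hypDist r)⁻¹ := h3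
    linarith
  refine ⟨_, image_mem_map hnear, ?_⟩
  rintro _ ⟨a, ha, rfl⟩ _ ⟨b, hb, rfl⟩
  have ha' : dist (G a) (G (r * (ζ₀ / ‖ζ₀‖))) < ε / 2 := ha
  have hb' : dist (G b) (G (r * (ζ₀ / ‖ζ₀‖))) < ε / 2 := hb
  have := dist_triangle_right (G a) (G b) (G (r * (ζ₀ / ‖ζ₀‖)))
  linarith

/-- At a boundary point the lift and the circles of the bundle have the same limit. -/
theorem IsNullLift.exists_boundary_limit (hX : IsNullLift h g F X) {ρ : ℝ} (hρ : ρ ≤ 1)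
    (hAW : AhlforsWeillCondition h g ρ) {ζ₀ : ℂ} (hζ₀ : ζ₀ ∈ circle) :
    ∃ q : OnePoint E3, Tendsto (fun z => (F z : OnePoint E3)) (𝓝[disk] ζ₀) (𝓝 q) ∧
      ∀ N ∈ 𝓝 q, ∀ᶠ z in 𝓝[disk] ζ₀, ∀ p ∈ diskCircle z, bestMobius h g F p z ∈ N := by
  obtain ⟨y, hy⟩ := hX.exists_tendsto_inversion hρ hAW hζ₀
  have hpos : ∀ᶠ z in 𝓝[disk] ζ₀, 0 < ‖z‖ := (tendsto_norm_nhdsWithin_disk hζ₀).eventually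
    (nhdsWithin_le_nhds (lt_mem_nhds zero_lt_one))
  refine ⟨uninvert (F 0) y, ?_, ?_⟩
  · refine (((continuous_uninvert (F 0)).tendsto y).comp hy).congr' ?_
    filter_upwards [hpos, self_mem_nhdsWithin] with z hz hzd
    have hzc : (‖z‖ : ℂ) ≠ 0 := by exact_mod_cast hz.ne'
    have hη : ‖z / (‖z‖ : ℂ)‖ = 1 := by
      rw [norm_div, Complex.norm_real, norm_norm, div_self hz.ne']
    have hne := (hX.slope_lower_bound hρ hAW ⟨hz, mem_disk.1 hzd⟩ hη).1
    have e1 : (‖z‖ : ℂ) * (z / ‖z‖) = z := by field_simp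
    rw [e1] at hne
    exact uninvert_inversion hne
  · intro N hN
    obtain ⟨ε, hε, hball⟩ := Metric.mem_nhds_iff.1 ((continuous_uninvert (F 0)).continuousAt hN)
    have h1 : ∀ᶠ z in 𝓝[disk] ζ₀, dist (inversion (F 0) 1 (F z)) y < ε / 2 :=
      hy.eventually (Metric.ball_mem_nhds _ (by positivity))
    have h2 : ∀ᶠ z in 𝓝[disk] ζ₀, (Real.exp (sigma h g 0) * hypDist ‖z‖)⁻¹ < ε / 2 :=
      ((tendsto_inv_mul_hypDist (Real.exp_pos (sigma h g 0))).comp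
        (tendsto_norm_nhdsWithin_disk hζ₀)).eventually (gt_mem_nhds (by positivity))
    filter_upwards [h1, h2, hpos, self_mem_nhdsWithin] with z hz1 hz2 hz hzd p hp
    obtain ⟨w, hw, hdist⟩ := hX.exists_uninvert_eq hρ hAW hzd (norm_pos_iff.1 hz) hp
    rw [hw]
    apply hball
    have := dist_triangle w (inversion (F 0) 1 (F z)) y
    rw [Metric.mem_ball]
    linarith

theorem reflectPoint_mem_diskCircle (z : ℂ) : reflectPoint z ∈ diskCircle z := by
  by_cases hz : z = 0
  · simp [reflectPoint, diskCircle, hz]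
  · rw [reflectPoint, diskCircle, if_neg hz, if_neg hz]
    refine ⟨_, ⟨⟨(‖z‖ ^ 2)⁻¹, ?_⟩, ?_⟩, rfl⟩
    · have e : ((embed (conj z)⁻¹) 0 : ℝ) = (conj z)⁻¹.re := rfl
      have e' : ((embed (conj z)⁻¹) 1 : ℝ) = (conj z)⁻¹.im := rfl
      have h1 : (⟨(embed (conj z)⁻¹) 0, (embed (conj z)⁻¹) 1⟩ : ℂ) = (conj z)⁻¹ := by
        rw [e, e']
      rw [h1, Complex.ofReal_inv, Complex.ofReal_pow, ← Complex.conj_mul']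
      have : conj z ≠ 0 := (map_ne_zero _).2 hz
      field_simp
    · simp

/-! ### The spherical distance near the diagonal. -/

section SphericalDist

theorem halfChord_nonneg (a b : OnePoint E3) : 0 ≤ halfChord a b := by
  induction a using OnePoint.rec <;> induction b using OnePoint.rec <;>
    simp only [halfChord] <;> positivity

/-- The triangle inequality through `∞`; it suffices for convergence to `∞`, where the Euclidean
formula is of no use. -/
theorem halfChord_le_add_infty (a b : OnePoint E3) :
    halfChord a b ≤ halfChord a OnePoint.infty + halfChord b OnePoint.infty := by
  induction a using OnePoint.rec with
  | infty => induction b using OnePoint.rec <;> simp [halfChord]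
  | coe u =>
    induction b using OnePoint.rec with
    | infty => simp [halfChord]
    | coe v =>
      simp only [halfChord]
      have hu : 0 < √(1 + ‖u‖ ^ 2) := by positivity
      have hv : 0 < √(1 + ‖v‖ ^ 2) := by positivity
      have hu' : ‖u‖ ≤ √(1 + ‖u‖ ^ 2) := Real.le_sqrt_of_sq_le (by linarith)
      have hv' : ‖v‖ ≤ √(1 + ‖v‖ ^ 2) := Real.le_sqrt_of_sq_le (by linarith)
      rw [div_add_div _ _ hu.ne' hv.ne', div_le_div_iff_of_pos_right (by positivity)]
      linarith [norm_sub_le u v]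

theorem tendsto_halfChord_infty :
    Tendsto (fun a => halfChord a OnePoint.infty) (𝓝 OnePoint.infty) (𝓝 0) := by
  rw [OnePoint.tendsto_nhds_infty']
  refine ⟨?_, ?_⟩
  · simpa [halfChord] using tendsto_pure_nhds (fun a => halfChord a OnePoint.infty) OnePoint.infty
  · rw [coclosedCompact_eq_cocompact, ← Metric.cobounded_eq_cocompact]
    have h1 : Tendsto (fun u : E3 => √(1 + ‖u‖ ^ 2)) (Bornology.cobounded E3) atTop := by
      refine tendsto_atTop_mono (fun u => ?_) tendsto_norm_cobounded_atTop
      exact Real.le_sqrt_of_sq_le (by linarith)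
    refine h1.inv_tendsto_atTop.congr fun u => ?_
    simp [halfChord]

/-- The spherical distance is continuous on the diagonal. -/
theorem tendsto_sphericalDist {ι : Type*} {l : Filter ι} {a b : ι → OnePoint E3} {q : OnePoint E3}
    (ha : Tendsto a l (𝓝 q)) (hb : Tendsto b l (𝓝 q)) :
    Tendsto (fun i => sphericalDist (a i) (b i)) l (𝓝 0) := by
  have key : Tendsto (fun i => halfChord (a i) (b i)) l (𝓝 0) := by
    induction q using OnePoint.rec with
    | infty =>
      have h1 := (tendsto_halfChord_infty.comp ha).add (tendsto_halfChord_infty.comp hb)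
      rw [add_zero] at h1
      exact squeeze_zero (fun i => halfChord_nonneg _ _) (fun i => halfChord_le_add_infty _ _) h1
    | coe x =>
      have h1 : Tendsto (fun p : OnePoint E3 × OnePoint E3 => halfChord p.1 p.2)
          (𝓝 (x : OnePoint E3) ×ˢ 𝓝 (x : OnePoint E3)) (𝓝 0) := by
        rw [OnePoint.nhds_coe_eq, prod_map_map_eq, tendsto_map'_iff, ← nhds_prod_eq]
        have h2 : ContinuousAt (fun p : E3 × E3 =>
            ‖p.1 - p.2‖ / (√(1 + ‖p.1‖ ^ 2) * √(1 + ‖p.2‖ ^ 2))) (x, x) := by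
          refine ContinuousAt.div (by fun_prop) (by fun_prop) ?_
          positivity
        have h3 := h2.tendsto
        simp only [sub_self, norm_zero, zero_div] at h3
        exact h3
      exact h1.comp (ha.prodMk hb)
  have h3 : Tendsto (fun t => 2 * Real.arcsin t) (𝓝 0) (𝓝 (2 * Real.arcsin 0)) :=
    (Real.continuous_arcsin.const_mul 2).tendsto 0 |>.congr fun _ => rfl
  rw [Real.arcsin_zero, mul_zero] at h3
  exact h3.comp key

end SphericalDist

/-! ### The circles orthogonal to the disk and their base points. -/

section DiskCircles

theorem norm_sq_eq_coords (u : E3) : ‖u‖ ^ 2 = ‖(⟨u 0, u 1⟩ : ℂ)‖ ^ 2 + u 2 ^ 2 := by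
  rw [EuclideanSpace.norm_sq_eq, Fin.sum_univ_three, ← Complex.normSq_eq_norm_sq,
    Complex.normSq_apply]
  simp [sq]

/-- The points of `diskCircle z`, in terms of the horizontal coordinate and the norm. -/
theorem coe_mem_diskCircle_iff {z : ℂ} {u : E3} :
    (u : OnePoint E3) ∈ diskCircle z ↔
      ((1 + ‖z‖ ^ 2 : ℝ) : ℂ) * ⟨u 0, u 1⟩ = ((1 + ‖u‖ ^ 2 : ℝ) : ℂ) * z := by
  by_cases hz : z = 0
  · simp [diskCircle, hz, Complex.ext_iff]
  have hz2 : z.re ^ 2 + z.im ^ 2 ≠ 0 := by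
    have := Complex.normSq_pos.2 hz
    rw [Complex.normSq_apply, ← sq, ← sq] at this
    exact this.ne'
  have hzn : ‖z‖ ^ 2 = z.re ^ 2 + z.im ^ 2 := by
    rw [← Complex.normSq_eq_norm_sq, Complex.normSq_apply]; ring
  have hun : ‖u‖ ^ 2 = u 0 ^ 2 + u 1 ^ 2 + u 2 ^ 2 := by
    rw [EuclideanSpace.norm_sq_eq, Fin.sum_univ_three]; simp
  constructor
  · intro hu
    obtain ⟨u', s, he, h0, h1, h2⟩ := exists_of_mem_diskCircle hz hu
    obtain rfl : u = u' := OnePoint.coe_injective he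
    have hs : 1 + ‖u‖ ^ 2 = s * (1 + ‖z‖ ^ 2) := by
      rw [hzn] at h2
      rw [hun, hzn, h0, h1]
      linear_combination h2
    rw [hs]
    apply Complex.ext
    · rw [Complex.re_ofReal_mul, Complex.re_ofReal_mul, h0]; ring
    · rw [Complex.im_ofReal_mul, Complex.im_ofReal_mul, h1]; ring
  · intro hu
    have hpos : 0 < 1 + ‖z‖ ^ 2 := by positivity
    set s := (1 + ‖u‖ ^ 2) / (1 + ‖z‖ ^ 2) with hs
    have hs' : s * (1 + ‖z‖ ^ 2) = 1 + ‖u‖ ^ 2 := by rw [hs]; field_simp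
    have h0 : u 0 = s * z.re := by
      have := congrArg Complex.re hu
      rw [Complex.re_ofReal_mul, Complex.re_ofReal_mul] at this
      rw [hs]
      field_simp
      linarith
    have h1 : u 1 = s * z.im := by
      have := congrArg Complex.im hu
      rw [Complex.im_ofReal_mul, Complex.im_ofReal_mul] at this
      rw [hs]
      field_simp
      linarith
    rw [diskCircle, if_neg hz]
    refine ⟨u, ⟨⟨s, ?_⟩, ?_⟩, rfl⟩
    · apply Complex.ext <;> simp [h0, h1]
    · rw [hun, hzn, h0, h1] at hs'
      rw [PiLp.inner_apply, Fin.sum_univ_three]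
      simp [embed, h0, h1, Complex.inv_re, Complex.inv_im, Complex.normSq_apply, ← sq]
      field_simp
      linear_combination -hs'

/-- Taking norms in the circle equation would give `1 + |z|² = 2 |z|`, that is `|z| = 1`. -/
theorem embed_notMem_diskCircle {ζ z : ℂ} (hζ : ζ ∈ circle) (hz : z ∈ disk) :
    ((embed ζ : E3) : OnePoint E3) ∉ diskCircle z := by
  intro h
  rw [coe_mem_diskCircle_iff, norm_sq_eq_coords] at h
  have e : (⟨(embed ζ) 0, (embed ζ) 1⟩ : ℂ) = ζ := rfl
  have e2 : (embed ζ) 2 = 0 := rfl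
  rw [e, e2, norm_eq_of_mem_circle hζ] at h
  have h1 := congrArg norm h
  rw [norm_mul, norm_mul, Complex.norm_real, Complex.norm_real, norm_eq_of_mem_circle hζ,
    Real.norm_of_nonneg (by positivity), Real.norm_of_nonneg (by positivity)] at h1
  have h2 := mem_disk.1 hz
  nlinarith

/-- The circles `diskCircle z` cover the space off the unit circle. -/
theorem exists_mem_diskCircle_or (u : E3) :
    (∃ z ∈ disk, (u : OnePoint E3) ∈ diskCircle z) ∨ ∃ ζ ∈ circle, u = embed ζ := by
  set w : ℂ := ⟨u 0, u 1⟩ with hw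
  have hun : ‖u‖ ^ 2 = ‖w‖ ^ 2 + u 2 ^ 2 := norm_sq_eq_coords u
  by_cases hw0 : w = 0
  · refine Or.inl ⟨0, by simp [mem_disk], ?_⟩
    rw [coe_mem_diskCircle_iff, ← hw, hw0]
    simp
  have hwpos : 0 < ‖w‖ := norm_pos_iff.2 hw0
  by_cases hc : ‖w‖ = 1 ∧ u 2 = 0
  · refine Or.inr ⟨w, mem_sphere_zero_iff_norm.2 hc.1, ?_⟩
    ext i
    fin_cases i <;> simp [embed, hw, hc.2]
  left
  -- `1 + |u|² - 2 |w| = (1 - |w|)² + u₂²`, which vanishes only on the unit circle.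
  have hneg : 2 * ‖w‖ - (1 + ‖u‖ ^ 2) < 0 := by
    rw [hun]
    rcases not_and_or.1 hc with h | h
    · have : 0 < (1 - ‖w‖) ^ 2 := by
        have : 1 - ‖w‖ ≠ 0 := fun h' => h (by linarith)
        positivity
      nlinarith [sq_nonneg (u 2)]
    · have : 0 < u 2 ^ 2 := by positivity
      nlinarith [sq_nonneg (1 - ‖w‖)]
  -- The base point is sought on the ray of `w` at radius `t`; the circle equation becomes this
  -- quadratic, positive at `0` and negative at `1`.
  have hcont : ContinuousOn (fun t : ℝ => (1 + t ^ 2) * ‖w‖ - (1 + ‖u‖ ^ 2) * t) (Icc 0 1) := by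
    fun_prop
  obtain ⟨t, ht, ht0⟩ := intermediate_value_Icc' zero_le_one hcont
    (show (0 : ℝ) ∈ Icc _ _ from ⟨by norm_num; linarith, by simp⟩)
  have ht1 : t ≠ 1 := by
    rintro rfl
    norm_num at ht0
    linarith
  have hwc : (‖w‖ : ℂ) ≠ 0 := by exact_mod_cast hwpos.ne'
  have hzn : ‖(t / ‖w‖ : ℝ) * w‖ = t := by
    rw [norm_mul, Complex.norm_real, Real.norm_of_nonneg (div_nonneg ht.1 hwpos.le)]
    field_simp
  refine ⟨(t / ‖w‖ : ℝ) * w, ?_, ?_⟩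
  · rw [mem_disk, hzn]
    exact lt_of_le_of_ne ht.2 ht1
  · rw [coe_mem_diskCircle_iff, hzn, ← hw, ← mul_assoc, ← Complex.ofReal_mul]
    congr 2
    have : (1 + t ^ 2) * ‖w‖ = (1 + ‖u‖ ^ 2) * t := by linarith [ht0]
    field_simp
    linarith

/-- A bound for the distance from `ζ` of the base point of a circle through `u`, which is small
for `u` near the point `ζ` of the unit circle. -/
def baseDistBound (ζ : ℂ) (u : E3) : ℝ :=
  √(2 * (1 - 2 * (‖(⟨u 0, u 1⟩ : ℂ)‖ / (1 + ‖u‖ ^ 2)))) +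
    ‖((2 / (1 + ‖u‖ ^ 2) : ℝ) : ℂ) * ⟨u 0, u 1⟩ - ζ‖

/-- With `v = 2 w / (1 + |u|²)`, the horizontal part of the stereographic image of `u`, the circle
equation says `z = (1 + |z|²) v / 2`. Hence `|z - v| ≤ 1 - |z|`, and `(1 - |z|)² = (1 + |z|²) (1 -
|v|) ≤ 2 (1 - |v|)`. -/
theorem norm_sub_le_baseDistBound {ζ z : ℂ} {u : E3} (hz : z ∈ disk)
    (hu : (u : OnePoint E3) ∈ diskCircle z) : ‖z - ζ‖ ≤ baseDistBound ζ u := by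
  rw [coe_mem_diskCircle_iff] at hu
  have hz1 := mem_disk.1 hz
  rw [baseDistBound]
  set w : ℂ := ⟨u 0, u 1⟩ with hw
  have hun : ‖u‖ ^ 2 = ‖w‖ ^ 2 + u 2 ^ 2 := norm_sq_eq_coords u
  have hpos : 0 < 1 + ‖u‖ ^ 2 := by positivity
  set v : ℂ := ((2 / (1 + ‖u‖ ^ 2) : ℝ) : ℂ) * w with hv
  set κ := ‖w‖ / (1 + ‖u‖ ^ 2) with hκ
  have hvn : ‖v‖ = 2 * κ := by
    rw [hv, norm_mul, Complex.norm_real, Real.norm_of_nonneg (by positivity), hκ]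
    ring
  have hv1 : ‖v‖ ≤ 1 := by
    rw [hvn, hκ, mul_div_assoc', div_le_one hpos, hun]
    nlinarith [sq_nonneg (1 - ‖w‖), sq_nonneg (u 2)]
  have hzv : z = (((1 + ‖z‖ ^ 2) / 2 : ℝ) : ℂ) * v := by
    have hpc : ((1 + ‖u‖ ^ 2 : ℝ) : ℂ) ≠ 0 := by exact_mod_cast hpos.ne'
    refine mul_left_cancel₀ hpc ?_
    rw [← hu, hv]
    rw [← mul_assoc, ← mul_assoc, ← Complex.ofReal_mul, ← Complex.ofReal_mul]
    congr 2
    field_simp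
  have hzn : ‖z‖ = (1 + ‖z‖ ^ 2) * κ := by
    have := congrArg norm hzv
    rw [norm_mul, Complex.norm_real, Real.norm_of_nonneg (by positivity), hvn] at this
    linarith
  have hκ0 : 0 ≤ 1 - 2 * κ := by linarith
  have h1 : 1 - ‖z‖ ≤ √(2 * (1 - 2 * κ)) := by
    refine Real.le_sqrt_of_sq_le ?_
    have : (1 - ‖z‖) ^ 2 = (1 + ‖z‖ ^ 2) * (1 - 2 * κ) := by linear_combination (-2) * hzn
    rw [this]
    gcongr
    nlinarith [norm_nonneg z]
  have h2 : ‖z - v‖ ≤ 1 - ‖z‖ := by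
    have e : z - v = (((‖z‖ ^ 2 - 1) / 2 : ℝ) : ℂ) * v := by
      rw [sub_eq_iff_eq_add]
      refine hzv.trans ?_
      push_cast
      ring
    rw [e, norm_mul, Complex.norm_real, Real.norm_eq_abs, abs_of_nonpos
      (by nlinarith [norm_nonneg z])]
    have h3 : 0 ≤ -((‖z‖ ^ 2 - 1) / 2) := by nlinarith [norm_nonneg z]
    calc -((‖z‖ ^ 2 - 1) / 2) * ‖v‖ ≤ -((‖z‖ ^ 2 - 1) / 2) * 1 := by gcongr
      _ ≤ 1 - ‖z‖ := by nlinarith [norm_nonneg z, sq_nonneg (1 - ‖z‖)]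
  have h3 := norm_sub_le_norm_sub_add_norm_sub z v ζ
  linarith

theorem continuous_horizontal : Continuous fun u : E3 => (⟨u 0, u 1⟩ : ℂ) := by
  have : (fun u : E3 => (⟨u 0, u 1⟩ : ℂ)) = fun u => (u 0 : ℂ) + u 1 * Complex.I := by
    funext u
    exact (Complex.re_add_im ⟨u 0, u 1⟩).symm
  rw [this]
  fun_prop

theorem tendsto_baseDistBound {ζ : ℂ} (hζ : ζ ∈ circle) :
    Tendsto (baseDistBound ζ) (𝓝 (embed ζ)) (𝓝 0) := by
  have hc : Continuous (baseDistBound ζ) := by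
    unfold baseDistBound
    have hpos : ∀ u : E3, 1 + ‖u‖ ^ 2 ≠ 0 := fun u => by positivity
    have h1 := continuous_horizontal
    have h2 : Continuous fun u : E3 => 1 + ‖u‖ ^ 2 := by fun_prop
    refine Continuous.add (Continuous.sqrt ?_) (Continuous.norm (Continuous.sub
      (Continuous.mul (Complex.continuous_ofReal.comp ?_) h1) continuous_const))
    · exact continuous_const.mul (continuous_const.sub (continuous_const.mul (h1.norm.div h2 hpos)))
    · exact continuous_const.div h2 hpos
  have hv : baseDistBound ζ (embed ζ) = 0 := by
    have e : (⟨(embed ζ) 0, (embed ζ) 1⟩ : ℂ) = ζ := rfl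
    have e2 : (embed ζ) 2 = 0 := rfl
    rw [baseDistBound, norm_sq_eq_coords, e, e2, norm_eq_of_mem_circle hζ]
    norm_num
  rw [← hv]
  exact hc.continuousAt

end DiskCircles

/-! ### The reflection and the extension at the boundary. -/

theorem IsNullLift.tendsto_boundaryExt (hX : IsNullLift h g F X) {ρ : ℝ} (hρ : ρ ≤ 1)
    (hAW : AhlforsWeillCondition h g ρ) {ζ₀ : ℂ} (hζ₀ : ζ₀ ∈ circle) :
    Tendsto (fun z => (F z : OnePoint E3)) (𝓝[disk] ζ₀) (𝓝 (boundaryExt F ζ₀)) ∧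
      ∀ N ∈ 𝓝 (boundaryExt F ζ₀),
        ∀ᶠ z in 𝓝[disk] ζ₀, ∀ p ∈ diskCircle z, bestMobius h g F p z ∈ N := by
  obtain ⟨q, h1, h2⟩ := hX.exists_boundary_limit hρ hAW hζ₀
  have : boundaryExt F ζ₀ = q := extendFrom_eq (mem_closure_disk hζ₀) h1
  rw [this]
  exact ⟨h1, h2⟩

theorem IsNullLift.tendsto_reflection (hX : IsNullLift h g F X) {ρ : ℝ} (hρ : ρ ≤ 1)
    (hAW : AhlforsWeillCondition h g ρ) {ζ₀ : ℂ} (hζ₀ : ζ₀ ∈ circle) :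
    Tendsto (reflection h g F) (𝓝[disk] ζ₀) (𝓝 (boundaryExt F ζ₀)) := by
  intro N hN
  rw [mem_map]
  filter_upwards [(hX.tendsto_boundaryExt hρ hAW hζ₀).2 N hN] with z hz
  exact hz _ (reflectPoint_mem_diskCircle z)

theorem IsNullLift.continuousOn_boundaryExt (hX : IsNullLift h g F X) {ρ : ℝ} (hρ : ρ ≤ 1)
    (hAW : AhlforsWeillCondition h g ρ) : ContinuousOn (boundaryExt F) circle :=
  continuousOn_extendFrom (fun _ hζ => mem_closure_disk hζ) fun _ hζ =>
    ⟨_, (hX.tendsto_boundaryExt hρ hAW hζ).1⟩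

theorem spaceExt_embed_of_mem_circle (h g : ℂ → ℂ) (F : ℂ → E3) {ζ : ℂ} (hζ : ζ ∈ circle) :
    spaceExt h g F ((embed ζ : E3) : OnePoint E3) = boundaryExt F ζ := by
  rw [spaceExt, dif_neg]
  · rfl
  · rintro ⟨z, hz, hmem⟩
    exact embed_notMem_diskCircle hζ hz hmem

/-- Points off the unit circle are handled by the shrinking of circles over base points near `ζ₀`,
points on it by continuity of the boundary values. The bound on the base point holds for every
circle through `u`, so it applies to whichever one the extension chooses. -/
theorem IsNullLift.continuousAt_spaceExt (hX : IsNullLift h g F X) {ρ : ℝ} (hρ : ρ ≤ 1)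
    (hAW : AhlforsWeillCondition h g ρ) {ζ₀ : ℂ} (hζ₀ : ζ₀ ∈ circle) :
    ContinuousAt (spaceExt h g F) ((embed ζ₀ : E3) : OnePoint E3) := by
  rw [ContinuousAt, spaceExt_embed_of_mem_circle h g F hζ₀, OnePoint.nhds_coe_eq, tendsto_map'_iff]
  intro N hN
  obtain ⟨δ, hδ, hball⟩ := Metric.mem_nhdsWithin_iff.1
    ((hX.tendsto_boundaryExt hρ hAW hζ₀).2 N hN)
  have hcirc := hX.continuousOn_boundaryExt hρ hAW ζ₀ hζ₀ hN
  obtain ⟨ε, hε, hball'⟩ := Metric.mem_nhdsWithin_iff.1 hcirc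
  have h1 : ∀ᶠ u in 𝓝 (embed ζ₀), baseDistBound ζ₀ u < δ :=
    (tendsto_baseDistBound hζ₀).eventually (gt_mem_nhds hδ)
  have h2 : ∀ᶠ u : E3 in 𝓝 (embed ζ₀), (⟨u 0, u 1⟩ : ℂ) ∈ Metric.ball ζ₀ ε :=
    continuous_horizontal.continuousAt.eventually (Metric.ball_mem_nhds _ hε)
  rw [mem_map]
  filter_upwards [h1, h2] with u hu1 hu2
  show spaceExt h g F (u : OnePoint E3) ∈ N
  by_cases hp : ∃ z ∈ disk, (u : OnePoint E3) ∈ diskCircle z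
  · rw [spaceExt, dif_pos hp]
    have hz := hp.choose_spec
    have hdist : hp.choose ∈ Metric.ball ζ₀ δ := by
      rw [Metric.mem_ball, dist_eq_norm]
      exact (norm_sub_le_baseDistBound hz.1 hz.2).trans_lt hu1
    exact hball ⟨hdist, hz.1⟩ _ hz.2
  · obtain ⟨ζ, hζ, rfl⟩ := (exists_mem_diskCircle_or u).resolve_left hp
    rw [spaceExt_embed_of_mem_circle h g F hζ]
    exact hball' ⟨hu2, hζ⟩

/-- Compactness of the closed disk upgrades the pointwise boundary limits to uniformity: an
ultrafilter along which `|ζ| → 1` from below converges to a point of the circle, where the lift and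
its reflection have the same limit. -/
theorem IsNullLift.tendsto_sphericalDist_reflection (hX : IsNullLift h g F X) {ρ : ℝ} (hρ : ρ ≤ 1)
    (hAW : AhlforsWeillCondition h g ρ) :
    Tendsto (fun ζ => sphericalDist (reflection h g F ζ) (F ζ : OnePoint E3))
      (comap (fun ζ : ℂ => ‖ζ‖) (𝓝[<] 1)) (𝓝 0) := by
  rw [tendsto_iff_ultrafilter]
  intro U hU
  have hnorm : Tendsto (fun ζ : ℂ => ‖ζ‖) U (𝓝[<] 1) := tendsto_iff_comap.2 hU
  have hdisk : ∀ᶠ ζ in (U : Filter ℂ), ζ ∈ disk := by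
    filter_upwards [hnorm self_mem_nhdsWithin] with ζ hζ using mem_disk.2 hζ
  obtain ⟨ζ₀, -, hle⟩ := (isCompact_closedBall (0 : ℂ) 1).ultrafilter_le_nhds U
    (le_principal_iff.2 (hdisk.mono fun ζ hζ => Metric.ball_subset_closedBall hζ))
  have hζ₀ : ζ₀ ∈ circle := by
    refine mem_sphere_zero_iff_norm.2 (tendsto_nhds_unique
      (continuous_norm.continuousAt.tendsto.mono_left hle) (hnorm.mono_right nhdsWithin_le_nhds))
  have hle' : (U : Filter ℂ) ≤ 𝓝[disk] ζ₀ := le_inf hle (le_principal_iff.2 hdisk)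
  exact tendsto_sphericalDist ((hX.tendsto_reflection hρ hAW hζ₀).mono_left hle')
    ((hX.tendsto_boundaryExt hρ hAW hζ₀).1.mono_left hle')

end

end HarmonicLift

open HarmonicLift
/- The hypotheses `hρ₀` and `hinj` are not needed: after the inversion about `F 0` the lift is
continuous up to the circle and the circles of the bundle shrink to points there, whether or not
the boundary values are distinct. -/
theorem theorem5 (h g : ℂ → ℂ) (F : ℂ → E3) (ρ : ℝ) (hρ₀ : 0 ≤ ρ) (hρ₁ : ρ ≤ 1)
    (hF : IsWeierstrassEnneperLift h g F)
    (hAW : AhlforsWeillCondition h g ρ)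
    (hinj : Set.InjOn (boundaryExt F) circle) :
    Filter.Tendsto (fun ζ => sphericalDist (reflection h g F ζ) (F ζ : OnePoint E3))
      (Filter.comap (fun ζ : ℂ => ‖ζ‖) (nhdsWithin 1 (Set.Iio 1))) (nhds 0) ∧
    (∀ ζ₀ ∈ circle,
      Filter.Tendsto (fun ζ => (F ζ : OnePoint E3)) (nhdsWithin ζ₀ disk)
        (nhds (boundaryExt F ζ₀)) ∧
      Filter.Tendsto (reflection h g F) (nhdsWithin ζ₀ disk) (nhds (boundaryExt F ζ₀))) ∧
    (∀ ζ₀ ∈ circle, spaceExt h g F ((embed ζ₀ : E3) : OnePoint E3) = boundaryExt F ζ₀ ∧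
      ContinuousAt (spaceExt h g F) ((embed ζ₀ : E3) : OnePoint E3)) := by
  obtain ⟨X, hX⟩ := hF.exists_isNullLift
  exact ⟨hX.tendsto_sphericalDist_reflection hρ₁ hAW,
    fun ζ₀ hζ₀ => ⟨(hX.tendsto_boundaryExt hρ₁ hAW hζ₀).1, hX.tendsto_reflection hρ₁ hAW hζ₀⟩,
    fun ζ₀ hζ₀ => ⟨spaceExt_embed_of_mem_circle h g F hζ₀,
      hX.continuousAt_spaceExt hρ₁ hAW hζ₀⟩⟩
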